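/- Work in the category $\mathbf{Loc}$ of locales (the opposite of the category of frames), which has pullbacks and coequalizers. A map of locales $f$ is open if its inverse image $f^*$ has a left adjoint $f_!$ with $f_!(a\wedge f^*(b))=f_!(a)\wedge b$ for all $a,b$, and it is a surjection if $f^*$ is injective. An open groupoid $G$ is an internal groupoid in $\mathbf{Loc}$ with arrows $G_1$, objects $G_0$, domain $d$, range $r$, units $u$, inversion $i$ and multiplication $m:G_1\times_{G_0}G_1\to G_1$ (defined on pairs $(g,g')$ with $r(g)=d(g')$), such that $d$ is open. For open groupoids $G,H$, a $G$-$H$-bilocale is a locale $X$ with a left $G$-action (anchor $p:X\to G_0$ and a unital, associative action $G_1\times_{G_0}X\to X$, $(g,x)\mapsto gx$, defined when $r(g)=p(x)$, with $p(gx)=d(g)$) and a right $H$-action (anchor $q:X\to H_0$ and a unital, associative action $X\times_{H_0}H_1\to X$, $(x,h)\mapsto xh$, defined when $q(x)=d(h)$, with $q(xh)=r(h)$), such that $q(gx)=q(x)$, $p(xh)=p(x)$ and $(gx)h=g(xh)$; all these identities are between maps of locales. Maps of bilocales are the maps of locales commuting with the anchors and actions. A $G$-$H$-bilocale is a principal $G$-$H$-bibundle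 if $q:X\to H_0$ is an open surjection and the pairing map $G_1\times_{G_0}X\to X\times_{H_0}X$, $(g,x)\mapsto(gx,x)$, is an isomorphism of locales. A Hilsum–Skandalis map from $H$ to $G$ is an isomorphism class of principal $G$-$H$-bibundles. For a $G$-$H$-bilocale $X$ and an $H$-$K$-bilocale $X'$, let $X\otimes_H X'$ be the coequalizer in $\mathbf{Loc}$ of the two maps $X\times_{H_0}H_1\times_{H_0}X'\rightrightarrows X\times_{H_0}X'$ given by $(x,h,x')\mapsto(xh,x')$ and $(x,h,x')\mapsto(x,hx')$, with quotient map $(x,x')\mapsto x\otimes x'$. **Lemma.** (1) Let $G,H,K$ be open groupoids, $X$ a principal $G$-$H$-bibundle and $X'$ a principal $H$-$K$-bibundle. Then there is exactly one $G$-$K$-bilocale structure on $X\otimes_H X'$ with $p(x\otimes x')=p(x)$, $q(x\otimes x')=q(x')$, $g(x\otimes x')=(gx)\otimes x'$ and $(x\otimes x')k=x\otimes(x'k)$, and with this structure $X\otimes_H X'$ is a principal $G$-$K$-bibundle. (2) Open groupoids and Hilsum–Skandalis maps form a category: the composite of the Hilsum–Skandalis maps $[X']:K\to H$ and $[X]:H\to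 G$ is $[X\otimes_H X']:K\to G$ (which is well defined on isomorphism classes), this composition is associative, and for every open groupoid $G$ the bilocale $G_1$, on which $G$ acts by multiplication on both sides, is a principal $G$-$G$-bibundle whose class is the identity of $G$. -/

import Mathlib

open CategoryTheory CategoryTheory.Limits

universe u

namespace FrameLimits

variable {A B C : Type u} [Order.Frame A] [Order.Frame B] [Order.Frame C]

lemma lower_mem {D : LowerSet (A × B)} {a a' : A} {b b' : B} (h : (a, b) ∈ D) (ha : a' ≤ a)
    (hb : b' ≤ b) : (a', b') ∈ D :=
  D.lower (Prod.mk_le_mk.2 ⟨ha, hb⟩) h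

/-- The frame of those down-sets `D` of `A × B` that are closed under joins in each variable and
balanced over `C`: it is the pushout of `f : C → A` and `g : C → B` in the category of frames. -/
def pushoutSublocale (f : FrameHom C A) (g : FrameHom C B) : Sublocale (LowerSet (A × B)) where
  carrier := {D | (∀ (s : Set A) (b : B), (∀ a ∈ s, (a, b) ∈ D) → (sSup s, b) ∈ D) ∧
    (∀ (a : A) (t : Set B), (∀ b ∈ t, (a, b) ∈ D) → (a, sSup t) ∈ D) ∧
    (∀ (a : A) (b : B) (c : C), (a ⊓ f c, b) ∈ D ↔ (a, b ⊓ g c) ∈ D)}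
  sInf_mem' S hS := by
    refine ⟨fun s b h => ?_, fun a t h => ?_, fun a b c => ?_⟩
    · simp only [LowerSet.mem_sInf_iff] at h ⊢
      exact fun D hD => (hS hD).1 s b fun a ha => h a ha D hD
    · simp only [LowerSet.mem_sInf_iff] at h ⊢
      exact fun D hD => (hS hD).2.1 a t fun b hb => h b hb D hD
    · simp only [LowerSet.mem_sInf_iff]
      exact forall₂_congr fun D hD => (hS hD).2.2 a b c
  himp_mem' E D hD := by
    have key : ∀ x : A × B, x ∈ E ⇨ D ↔ ∀ y ≤ x, y ∈ E → y ∈ D := by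
      intro x
      rw [← LowerSet.Iic_le, le_himp_iff]
      constructor
      · intro h y hy hE
        exact h ⟨hy, hE⟩
      · rintro h y ⟨hy, hE⟩
        exact h y hy hE
    obtain ⟨h1, h2, h3⟩ := hD
    refine ⟨fun s b h => ?_, fun a t h => ?_, fun a b c => ?_⟩
    · rw [key]
      rintro ⟨a', b'⟩ ⟨ha, hb⟩ hE
      have e : a' = sSup ((fun x => a' ⊓ x) '' s) := by
        rw [sSup_image, ← inf_sSup_eq]; exact (inf_eq_left.2 ha).symm
      rw [e]
      refine h1 _ _ ?_
      rintro _ ⟨x, hx, rfl⟩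
      exact (key _).1 (h x hx) _ ⟨inf_le_right, hb⟩ (lower_mem hE inf_le_left le_rfl)
    · rw [key]
      rintro ⟨a', b'⟩ ⟨ha, hb⟩ hE
      have e : b' = sSup ((fun x => b' ⊓ x) '' t) := by
        rw [sSup_image, ← inf_sSup_eq]; exact (inf_eq_left.2 hb).symm
      rw [e]
      refine h2 _ _ ?_
      rintro _ ⟨x, hx, rfl⟩
      exact (key _).1 (h x hx) _ ⟨ha, inf_le_right⟩ (lower_mem hE le_rfl inf_le_left)
    · rw [key, key]
      constructor
      · rintro h ⟨a', b'⟩ ⟨ha, hb⟩ hE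
        have := h (a' ⊓ f c, b') ⟨inf_le_inf_right _ ha, hb.trans inf_le_left⟩
          (lower_mem hE inf_le_left le_rfl)
        have h4 := (h3 _ _ _).1 this
        rwa [inf_eq_left.2 (hb.trans inf_le_right)] at h4
      · rintro h ⟨a', b'⟩ ⟨ha, hb⟩ hE
        have := h (a', b' ⊓ g c) ⟨ha.trans inf_le_left, inf_le_inf_right _ hb⟩
          (lower_mem hE le_rfl inf_le_left)
        have h4 := (h3 _ _ _).2 this
        rwa [inf_eq_left.2 (ha.trans inf_le_right)] at h4

variable (f : FrameHom C A) (g : FrameHom C B)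

/-- The pure tensor `a ⊗ b`. -/
def tmul (a : A) (b : B) : pushoutSublocale f g :=
  (pushoutSublocale f g).restrict (LowerSet.Iic (a, b))

lemma tmul_le {a : A} {b : B} {D : pushoutSublocale f g} : tmul f g a b ≤ D ↔ (a, b) ∈ D.1 := by
  rw [tmul, (pushoutSublocale f g).giRestrict.gc.le_iff_le, LowerSet.Iic_le]

lemma tmul_inf (a a' : A) (b b' : B) :
    tmul f g (a ⊓ a') (b ⊓ b') = tmul f g a b ⊓ tmul f g a' b' := by
  simp only [tmul, ← map_inf, ← LowerSet.Iic_inf, Prod.mk_inf_mk]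

lemma tmul_top : tmul f g ⊤ ⊤ = ⊤ := by
  rw [tmul, ← map_top (pushoutSublocale f g).restrict]
  congr 1
  exact LowerSet.Iic_top

/-- The first coprojection of the pushout of frames. -/
def inl : FrameHom A (pushoutSublocale f g) where
  toFun a := tmul f g a ⊤
  map_inf' a a' := by rw [← tmul_inf, inf_idem]
  map_top' := tmul_top f g
  map_sSup' s := by
    refine eq_of_forall_ge_iff fun D => ?_
    rw [tmul_le, sSup_le_iff, Set.forall_mem_image]
    simp only [tmul_le]
    exact ⟨fun h a ha => lower_mem h (le_sSup ha) le_rfl, D.2.1 s ⊤⟩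

/-- The second coprojection of the pushout of frames. -/
def inr : FrameHom B (pushoutSublocale f g) where
  toFun b := tmul f g ⊤ b
  map_inf' a a' := by rw [← tmul_inf, inf_idem]
  map_top' := tmul_top f g
  map_sSup' s := by
    refine eq_of_forall_ge_iff fun D => ?_
    rw [tmul_le, sSup_le_iff, Set.forall_mem_image]
    simp only [tmul_le]
    exact ⟨fun h a ha => lower_mem h le_rfl (le_sSup ha), D.2.2.1 ⊤ s⟩

lemma inl_comp : (inl f g).comp f = (inr f g).comp g := by
  ext c : 1
  refine eq_of_forall_ge_iff fun D => ?_
  change tmul f g (f c) ⊤ ≤ D ↔ tmul f g ⊤ (g c) ≤ D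
  rw [tmul_le, tmul_le]
  have := D.2.2.2 ⊤ ⊤ c
  rwa [top_inf_eq, top_inf_eq] at this

lemma inl_inf_inr (a : A) (b : B) : inl f g a ⊓ inr f g b = tmul f g a b := by
  change tmul f g a ⊤ ⊓ tmul f g ⊤ b = _
  rw [← tmul_inf, inf_top_eq, top_inf_eq]

lemma eq_iSup_tmul (D : pushoutSublocale f g) :
    D = ⨆ x ∈ D.1, inl f g x.1 ⊓ inr f g x.2 := by
  refine eq_of_forall_ge_iff fun E => ?_
  simp only [iSup_le_iff, inl_inf_inr, tmul_le]
  rfl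

variable {f g} {Z : Type u} [Order.Frame Z] (h : FrameHom A Z) (k : FrameHom B Z)

/-- The right adjoint of the frame homomorphism induced by a cocone. -/
def descAdj (w : h.comp f = k.comp g) (z : Z) : pushoutSublocale f g :=
  ⟨⟨{x | h x.1 ⊓ k x.2 ≤ z}, fun x y hyx hx =>
    (inf_le_inf (OrderHomClass.mono h hyx.1) (OrderHomClass.mono k hyx.2)).trans hx⟩, by
    have w' : ∀ c, h (f c) = k (g c) := fun c => DFunLike.congr_fun w c
    refine ⟨fun s b hs => ?_, fun a t ht => ?_, fun a b c => ?_⟩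
    · change h (sSup s) ⊓ k b ≤ z
      rw [map_sSup, sSup_inf_eq, iSup₂_le_iff]
      rintro _ ⟨a, ha, rfl⟩
      exact hs a ha
    · change h a ⊓ k (sSup t) ≤ z
      rw [map_sSup, inf_sSup_eq, iSup₂_le_iff]
      rintro _ ⟨b, hb, rfl⟩
      exact ht b hb
    · change h (a ⊓ f c) ⊓ k b ≤ z ↔ h a ⊓ k (b ⊓ g c) ≤ z
      rw [map_inf, map_inf, w', inf_assoc, inf_comm (k b)]⟩

lemma desc_gc (w : h.comp f = k.comp g) : GaloisConnection
    (fun D : pushoutSublocale f g => ⨆ x ∈ D.1, h x.1 ⊓ k x.2) (descAdj h k w) := by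
  intro D z
  rw [iSup₂_le_iff]
  rfl

/-- The frame homomorphism out of a pushout of frames induced by a cocone. -/
def desc (w : h.comp f = k.comp g) : FrameHom (pushoutSublocale f g) Z where
  toFun D := ⨆ x ∈ D.1, h x.1 ⊓ k x.2
  map_inf' D E := by
    apply le_antisymm
    · refine le_inf ?_ ?_ <;> refine iSup₂_le fun x hx => ?_
      · exact le_iSup₂ (f := fun (x : A × B) (_ : x ∈ D.1) => h x.1 ⊓ k x.2) x hx.1
      · exact le_iSup₂ (f := fun (x : A × B) (_ : x ∈ E.1) => h x.1 ⊓ k x.2) x hx.2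
    · simp only [iSup_inf_eq, inf_iSup_eq]
      refine iSup₂_le fun y hy => iSup₂_le fun x hx => ?_
      have hm : x ⊓ y ∈ (D ⊓ E : pushoutSublocale f g).1 := by
        exact ⟨D.1.lower inf_le_left hx, E.1.lower inf_le_right hy⟩
      refine le_trans ?_ (le_iSup₂ (x ⊓ y) hm)
      simp only [Prod.fst_inf, Prod.snd_inf, map_inf]
      exact le_of_eq (by ac_rfl)
  map_top' := by
    refine top_le_iff.1 ?_
    have hm : (⊤ : A × B) ∈ (⊤ : pushoutSublocale f g).1 := trivial
    refine le_trans ?_ (le_iSup₂ (⊤ : A × B) hm)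
    simp
  map_sSup' S := by
    rw [(desc_gc h k w).l_sSup, sSup_image]

lemma desc_tmul (w : h.comp f = k.comp g) (a : A) (b : B) :
    desc h k w (tmul f g a b) = h a ⊓ k b := by
  refine eq_of_forall_ge_iff fun z => ?_
  exact (desc_gc h k w _ _).trans (tmul_le f g)

lemma desc_inl (w : h.comp f = k.comp g) : (desc h k w).comp (inl f g) = h := by
  ext a
  refine (desc_tmul h k w a ⊤).trans ?_
  rw [map_top, inf_top_eq]

lemma desc_inr (w : h.comp f = k.comp g) : (desc h k w).comp (inr f g) = k := by
  ext b
  refine (desc_tmul h k w ⊤ b).trans ?_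
  rw [map_top, top_inf_eq]

lemma hom_ext {m n : FrameHom (pushoutSublocale f g) Z} (hl : m.comp (inl f g) = n.comp (inl f g))
    (hr : m.comp (inr f g) = n.comp (inr f g)) : m = n := by
  have hl' : ∀ a, m (inl f g a) = n (inl f g a) := fun a => DFunLike.congr_fun hl a
  have hr' : ∀ b, m (inr f g b) = n (inr f g b) := fun b => DFunLike.congr_fun hr b
  ext D
  rw [eq_iSup_tmul f g D]
  simp only [map_iSup, map_inf, hl', hr']

/-- The subframe of elements on which two frame homomorphisms agree: their equalizer. -/
abbrev Equ (f g : FrameHom A B) : Type u := {x : A // f x = g x}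

namespace Equ

variable (f g : FrameHom A B)

instance : SupSet (Equ f g) where
  sSup S := ⟨sSup (Subtype.val '' S), by
    simp only [map_sSup]
    congr 1
    rw [Set.image_image, Set.image_image]
    exact Set.image_congr fun x _ => x.2⟩

instance : CompleteLattice (Equ f g) where
  __ := completeLatticeOfSup (Equ f g) fun S =>
    ⟨fun _ hx => le_sSup (α := A) (Set.mem_image_of_mem _ hx), fun _ hy => sSup_le (α := A) (by
      rintro _ ⟨x, hx, rfl⟩
      exact hy hx)⟩
  inf x y := ⟨x.1 ⊓ y.1, by rw [map_inf, map_inf, x.2, y.2]⟩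
  inf_le_left x _ := inf_le_left (a := x.1)
  inf_le_right x _ := inf_le_right (a := x.1)
  le_inf _ _ _ h h' := le_inf (α := A) h h'
  top := ⟨⊤, by rw [map_top, map_top]⟩
  le_top x := le_top (a := x.1)

/-- The inclusion of the equalizer of two frame homomorphisms preserves suprema. -/
lemma coe_sSup (S : Set (Equ f g)) : (sSup S).1 = sSup (Subtype.val '' S) := rfl

instance : Order.Frame (Equ f g) := Order.Frame.ofMinimalAxioms {
  inf_sSup_le_iSup_inf := fun a S => by
    change a.1 ⊓ (sSup S).1 ≤ (⨆ b ∈ S, a ⊓ b : Equ f g).1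
    rw [coe_sSup, inf_sSup_eq]
    refine iSup₂_le ?_
    rintro _ ⟨b, hb, rfl⟩
    exact le_iSup₂ (f := fun (b : Equ f g) (_ : b ∈ S) => a ⊓ b) b hb }

/-- The inclusion of the equalizer of two frame homomorphisms. -/
def incl : FrameHom (Equ f g) A where
  toFun := Subtype.val
  map_inf' _ _ := rfl
  map_top' := rfl
  map_sSup' _ := rfl

lemma comp_incl : f.comp (incl f g) = g.comp (incl f g) :=
  FrameHom.ext fun x => x.2

variable {f g}

/-- The universal property of the equalizer of two frame homomorphisms. -/
def lift (h : FrameHom C A) (w : f.comp h = g.comp h) : FrameHom C (Equ f g) where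
  toFun c := ⟨h c, DFunLike.congr_fun w c⟩
  map_inf' a b := Subtype.ext (map_inf h a b)
  map_top' := Subtype.ext (map_top h)
  map_sSup' S := Subtype.ext (by
    rw [coe_sSup, Set.image_image]
    exact map_sSup h S)

end Equ

instance : HasPushouts Frm.{u} :=
  haveI : ∀ {X Y Z : Frm.{u}} {f : X ⟶ Y} {g : X ⟶ Z}, HasColimit (span f g) := by
    intro X Y Z f g
    have w : ∀ s : PushoutCocone f g, s.inl.hom.comp f.hom = s.inr.hom.comp g.hom :=
      fun s => congrArg Frm.Hom.hom s.condition
    exact ⟨⟨⟨_, PushoutCocone.IsColimit.mk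
      (W := Frm.of (pushoutSublocale f.hom g.hom)) (inl := Frm.ofHom (inl f.hom g.hom))
      (inr := Frm.ofHom (inr f.hom g.hom)) (Frm.hom_ext (inl_comp f.hom g.hom))
      (fun s => Frm.ofHom (desc s.inl.hom s.inr.hom (w s)))
      (fun s => Frm.hom_ext (desc_inl _ _ (w s))) (fun s => Frm.hom_ext (desc_inr _ _ (w s)))
      (fun s m h₁ h₂ => Frm.hom_ext (hom_ext
        ((congrArg Frm.Hom.hom h₁).trans (desc_inl _ _ (w s)).symm)
        ((congrArg Frm.Hom.hom h₂).trans (desc_inr _ _ (w s)).symm)))⟩⟩⟩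
  hasPushouts_of_hasColimit_span _

instance : HasEqualizers Frm.{u} :=
  haveI : ∀ {X Y : Frm.{u}} {f g : X ⟶ Y}, HasLimit (parallelPair f g) :=
    fun {_ _ f g} => ⟨⟨⟨Fork.ofι (P := Frm.of (Equ f.hom g.hom))
      (Frm.ofHom (Equ.incl f.hom g.hom)) (Frm.hom_ext (Equ.comp_incl f.hom g.hom)),
      Fork.IsLimit.mk _ (fun s => Frm.ofHom (Equ.lift s.ι.hom (congrArg Frm.Hom.hom s.condition)))
        (fun _ => rfl) (fun _ _ h => Frm.hom_ext (FrameHom.ext fun x => Subtype.ext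
          (DFunLike.congr_fun (congrArg Frm.Hom.hom h) x)))⟩⟩⟩
  hasEqualizers_of_hasLimit_parallelPair _

end FrameLimits

instance : HasPullbacks Locale.{u} := inferInstanceAs (HasPullbacks Frm.{u}ᵒᵖ)

instance : HasCoequalizers Locale.{u} := inferInstanceAs (HasCoequalizers Frm.{u}ᵒᵖ)

namespace Locale

/-- The inverse image homomorphism `f^*` of a map of locales `f : X ⟶ Y`. -/
def invImage {X Y : Locale.{u}} (f : X ⟶ Y) : FrameHom Y X := Frm.Hom.hom (Quiver.Hom.unop f)

/-- A map of locales is open if its inverse image homomorphism has a left adjoint (the direct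
image) satisfying the Frobenius condition. -/
def IsOpenMap {X Y : Locale.{u}} (f : X ⟶ Y) : Prop :=
  ∃ direct : X → Y, GaloisConnection direct (invImage f) ∧
    ∀ (a : X) (b : Y), direct (a ⊓ invImage f b) = direct a ⊓ b

/-- A map of locales is a surjection if its inverse image homomorphism is injective. -/
def IsSurjection {X Y : Locale.{u}} (f : X ⟶ Y) : Prop := Function.Injective (invImage f)

end Locale

/-- A localic groupoid: an internal groupoid in the category of locales, with domain `d`, range `r`,
units `u`, inversion `i` and multiplication `m`, where `m (g, h)` is defined when `r g = d h`.
The associativity law is stated for generalized elements `f`, `g`, `h` of the locale of arrows. -/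
structure LocalicGroupoid where
  /-- The locale of objects. -/
  G₀ : Locale.{u}
  /-- The locale of arrows. -/
  G₁ : Locale.{u}
  d : G₁ ⟶ G₀
  r : G₁ ⟶ G₀
  u : G₀ ⟶ G₁
  i : G₁ ⟶ G₁
  m : pullback r d ⟶ G₁
  u_d : u ≫ d = 𝟙 G₀
  u_r : u ≫ r = 𝟙 G₀
  i_d : i ≫ d = r
  i_r : i ≫ r = d
  m_d : m ≫ d = pullback.fst r d ≫ d
  m_r : m ≫ r = pullback.snd r d ≫ r
  mul_assoc : ∀ {Z : Locale.{u}} (f g h : Z ⟶ G₁) (w₁ : f ≫ r = g ≫ d) (w₂ : g ≫ r = h ≫ d),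
    pullback.lift (pullback.lift f g w₁ ≫ m) h
      (by rw [Category.assoc, m_r, pullback.lift_snd_assoc, w₂]) ≫ m =
      pullback.lift f (pullback.lift g h w₂ ≫ m)
        (by rw [Category.assoc, m_d, pullback.lift_fst_assoc, w₁]) ≫ m
  one_mul : pullback.lift (d ≫ u) (𝟙 G₁) (by simp [u_r]) ≫ m = 𝟙 G₁
  mul_one : pullback.lift (𝟙 G₁) (r ≫ u) (by simp [u_d]) ≫ m = 𝟙 G₁
  inv_mul : pullback.lift i (𝟙 G₁) (by simp [i_r]) ≫ m = r ≫ u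
  mul_inv : pullback.lift (𝟙 G₁) i (by simp [i_d]) ≫ m = d ≫ u

/-- An open groupoid: a localic groupoid whose domain map is open. -/
structure OpenGroupoid extends LocalicGroupoid.{u} where
  isOpenMap_d : Locale.IsOpenMap d

/-- The structure of a left `G`-locale on `X`: an anchor map `p` and an action `(g, x) ↦ g x`,
defined when `r g = p x`. Associativity is stated for generalized elements. -/
structure LeftAction (G : OpenGroupoid.{u}) (X : Locale.{u}) where
  p : X ⟶ G.G₀
  act : pullback G.r p ⟶ X
  act_p : act ≫ p = pullback.fst G.r p ≫ G.d
  mul_act : ∀ {Z : Locale.{u}} (g g' : Z ⟶ G.G₁) (x : Z ⟶ X) (w₁ : g ≫ G.r = g' ≫ G.d)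
    (w₂ : g' ≫ G.r = x ≫ p),
    pullback.lift (pullback.lift g g' w₁ ≫ G.m) x
      (by rw [Category.assoc, G.m_r, pullback.lift_snd_assoc, w₂]) ≫ act =
      pullback.lift g (pullback.lift g' x w₂ ≫ act)
        (by rw [Category.assoc, act_p, pullback.lift_fst_assoc, w₁]) ≫ act
  one_act : pullback.lift (p ≫ G.u) (𝟙 X) (by simp [G.u_r]) ≫ act = 𝟙 X

/-- The structure of a right `H`-locale on `X`: an anchor map `q` and an action `(x, h) ↦ x h`,
defined when `q x = d h`. Associativity is stated for generalized elements. -/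
structure RightAction (H : OpenGroupoid.{u}) (X : Locale.{u}) where
  q : X ⟶ H.G₀
  ract : pullback q H.d ⟶ X
  ract_q : ract ≫ q = pullback.snd q H.d ≫ H.r
  ract_mul : ∀ {Z : Locale.{u}} (x : Z ⟶ X) (h h' : Z ⟶ H.G₁) (w₁ : x ≫ q = h ≫ H.d)
    (w₂ : h ≫ H.r = h' ≫ H.d),
    pullback.lift (pullback.lift x h w₁ ≫ ract) h'
      (by rw [Category.assoc, ract_q, pullback.lift_snd_assoc, w₂]) ≫ ract =
      pullback.lift x (pullback.lift h h' w₂ ≫ H.m)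
        (by rw [Category.assoc, H.m_d, pullback.lift_fst_assoc, w₁]) ≫ ract
  ract_one : pullback.lift (𝟙 X) (q ≫ H.u) (by simp [H.u_d]) ≫ ract = 𝟙 X

/-- The structure of a `G`-`H`-bilocale on `X`: commuting left and right actions such that each
anchor map is invariant under the other action. -/
structure BilocaleStr (G H : OpenGroupoid.{u}) (X : Locale.{u}) extends
    LeftAction G X, RightAction H X where
  act_q : act ≫ q = pullback.snd G.r p ≫ q
  ract_p : ract ≫ p = pullback.fst q H.d ≫ p
  act_ract : ∀ {Z : Locale.{u}} (g : Z ⟶ G.G₁) (x : Z ⟶ X) (h : Z ⟶ H.G₁)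
    (w₁ : g ≫ G.r = x ≫ p) (w₂ : x ≫ q = h ≫ H.d),
    pullback.lift (pullback.lift g x w₁ ≫ act) h
      (by rw [Category.assoc, act_q, pullback.lift_snd_assoc, w₂]) ≫ ract =
      pullback.lift g (pullback.lift x h w₂ ≫ ract)
        (by rw [Category.assoc, ract_p, pullback.lift_fst_assoc, w₁]) ≫ act

/-- A left `G`-locale `X` with a map `π : X ⟶ M` is a principal `G`-bundle over `M` if `π` is
invariant, the pairing map `⟨act, π₂⟩ : G₁ ×_{G₀} X ⟶ X ×_M X` is an isomorphism and `π` is an open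
surjection. -/
structure LeftAction.IsPrincipalBundle {G : OpenGroupoid.{u}} {X M : Locale.{u}}
    (S : LeftAction G X) (π : X ⟶ M) : Prop where
  invariant : S.act ≫ π = pullback.snd G.r S.p ≫ π
  isIso_pairing : IsIso (pullback.lift S.act (pullback.snd G.r S.p) invariant : _ ⟶ pullback π π)
  isOpenMap : Locale.IsOpenMap π
  isSurjection : Locale.IsSurjection π

namespace BilocaleStr

variable {G H K : OpenGroupoid.{u}} {X X' : Locale.{u}}

/-- A principal `G`-`H`-bibundle: a `G`-`H`-bilocale that is a principal `G`-bundle over `H₀`. -/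
def IsPrincipal (S : BilocaleStr G H X) : Prop := S.toLeftAction.IsPrincipalBundle S.q

/-- The map `(x, h, x') ↦ (x h, x')` from `X ×_{H₀} H₁ ×_{H₀} X'` to `X ×_{H₀} X'`. -/
noncomputable def tensorLeft (S : BilocaleStr G H X) (S' : BilocaleStr H K X') :
    pullback (pullback.snd S.q H.d ≫ H.r) S'.p ⟶ pullback S.q S'.p :=
  pullback.lift (pullback.fst _ _ ≫ S.ract) (pullback.snd _ _)
    (by rw [Category.assoc, S.ract_q, pullback.condition])

/-- The map `(x, h, x') ↦ (x, h x')` from `X ×_{H₀} H₁ ×_{H₀} X'` to `X ×_{H₀} X'`. -/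
noncomputable def tensorRight (S : BilocaleStr G H X) (S' : BilocaleStr H K X') :
    pullback (pullback.snd S.q H.d ≫ H.r) S'.p ⟶ pullback S.q S'.p :=
  pullback.lift (pullback.fst _ _ ≫ pullback.fst _ _)
    (pullback.lift (pullback.fst _ _ ≫ pullback.snd _ _) (pullback.snd _ _)
      (by rw [Category.assoc, pullback.condition]) ≫ S'.act)
    (by rw [Category.assoc, pullback.condition, Category.assoc, S'.act_p,
      pullback.lift_fst_assoc, Category.assoc])

/-- The locale `X ⊗_H X'`: the coequalizer in locales of `(x, h, x') ↦ (x h, x')` and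
`(x, h, x') ↦ (x, h x')`. -/
noncomputable def tensor (S : BilocaleStr G H X) (S' : BilocaleStr H K X') : Locale.{u} :=
  coequalizer (tensorLeft S S') (tensorRight S S')

/-- The quotient map `(x, x') ↦ x ⊗ x'` from `X ×_{H₀} X'` to `X ⊗_H X'`. -/
noncomputable def tensorProj (S : BilocaleStr G H X) (S' : BilocaleStr H K X') :
    pullback S.q S'.p ⟶ tensor S S' :=
  coequalizer.π (tensorLeft S S') (tensorRight S S')

/-- A `G`-`K`-bilocale structure on `X ⊗_H X'` is the one induced by `X` and `X'` if
`p (x ⊗ x') = p x`, `q (x ⊗ x') = q x'`, `g (x ⊗ x') = (g x) ⊗ x'` and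
`(x ⊗ x') k = x ⊗ (x' k)`, for generalized elements. -/
structure IsInduced (S : BilocaleStr G H X) (S' : BilocaleStr H K X')
    (T : BilocaleStr G K (tensor S S')) : Prop where
  proj_p : tensorProj S S' ≫ T.p = pullback.fst _ _ ≫ S.p
  proj_q : tensorProj S S' ≫ T.q = pullback.snd _ _ ≫ S'.q
  act_proj : ∀ {Z : Locale.{u}} (g : Z ⟶ G.G₁) (x : Z ⟶ X) (x' : Z ⟶ X')
    (w₁ : g ≫ G.r = x ≫ S.p) (w₂ : x ≫ S.q = x' ≫ S'.p),
    pullback.lift g (pullback.lift x x' w₂ ≫ tensorProj S S')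
      (by rw [Category.assoc, proj_p, pullback.lift_fst_assoc, w₁]) ≫ T.act =
      pullback.lift (pullback.lift g x w₁ ≫ S.act) x'
        (by rw [Category.assoc, S.act_q, pullback.lift_snd_assoc, w₂]) ≫ tensorProj S S'
  ract_proj : ∀ {Z : Locale.{u}} (x : Z ⟶ X) (x' : Z ⟶ X') (k : Z ⟶ K.G₁)
    (w₁ : x ≫ S.q = x' ≫ S'.p) (w₂ : x' ≫ S'.q = k ≫ K.d),
    pullback.lift (pullback.lift x x' w₁ ≫ tensorProj S S') k
      (by rw [Category.assoc, proj_q, pullback.lift_snd_assoc, w₂]) ≫ T.ract =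
      pullback.lift x (pullback.lift x' k w₂ ≫ S'.ract)
        (by rw [Category.assoc, S'.ract_p, pullback.lift_fst_assoc, w₁]) ≫ tensorProj S S'

/-- The `G`-`G`-bilocale `G₁`, on which `G` acts by multiplication on both sides. -/
def unit (G : OpenGroupoid.{u}) : BilocaleStr G G G.G₁ where
  p := G.d
  act := G.m
  act_p := G.m_d
  mul_act := G.mul_assoc
  one_act := G.one_mul
  q := G.r
  ract := G.m
  ract_q := G.m_r
  ract_mul := G.mul_assoc
  ract_one := G.mul_one
  act_q := G.m_r
  ract_p := G.m_d
  act_ract := G.mul_assoc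

end BilocaleStr

/-- A `G`-`H`-bilocale. -/
structure Bilocale (G H : OpenGroupoid.{u}) where
  X : Locale.{u}
  str : BilocaleStr G H X

namespace Bilocale

variable {G H : OpenGroupoid.{u}}

/-- A map of bilocales: a map of locales that commutes with the anchor maps and with both
actions. -/
@[ext]
structure Hom (A B : Bilocale G H) where
  f : A.X ⟶ B.X
  f_p : f ≫ B.str.p = A.str.p
  f_q : f ≫ B.str.q = A.str.q
  act_f : A.str.act ≫ f = pullback.lift (pullback.fst G.r A.str.p) (pullback.snd G.r A.str.p ≫ f)
    (by rw [Category.assoc, f_p, pullback.condition]) ≫ B.str.act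
  ract_f : A.str.ract ≫ f = pullback.lift (pullback.fst A.str.q H.d ≫ f) (pullback.snd A.str.q H.d)
    (by rw [Category.assoc, f_q, pullback.condition]) ≫ B.str.ract

instance : Category (Bilocale G H) where
  Hom := Hom
  id A :=
    { f := 𝟙 A.X
      f_p := Category.id_comp _
      f_q := Category.id_comp _
      act_f := by
        rw [Category.comp_id, ← Category.id_comp A.str.act]
        congr 1
        ext <;> simp
      ract_f := by
        rw [Category.comp_id, ← Category.id_comp A.str.ract]
        congr 1
        ext <;> simp }
  comp {A B C} φ ψ :=
    { f := φ.f ≫ ψ.f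
      f_p := by rw [Category.assoc, ψ.f_p, φ.f_p]
      f_q := by rw [Category.assoc, ψ.f_q, φ.f_q]
      act_f := by
        rw [← Category.assoc, φ.act_f, Category.assoc, ψ.act_f, ← Category.assoc]
        congr 1
        ext <;> simp [pullback.lift_fst, pullback.lift_snd, pullback.lift_snd_assoc]
      ract_f := by
        rw [← Category.assoc, φ.ract_f, Category.assoc, ψ.ract_f, ← Category.assoc]
        congr 1
        ext <;> simp [pullback.lift_fst, pullback.lift_snd, pullback.lift_fst_assoc] }
  id_comp _ := Hom.ext (Category.id_comp _)
  comp_id _ := Hom.ext (Category.comp_id _)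
  assoc _ _ _ := Hom.ext (Category.assoc _ _ _)

end Bilocale

/-- The category of principal `G`-`H`-bibundles, a full subcategory of the category of
`G`-`H`-bilocales. -/
abbrev PrincipalBibundle (G H : OpenGroupoid.{u}) : Type (u + 1) :=
  ObjectProperty.FullSubcategory fun A : Bilocale G H => A.str.IsPrincipal

/-- A Hilsum--Skandalis map from `H` to `G`: an isomorphism class of principal
`G`-`H`-bibundles. -/
def HSMap (H G : OpenGroupoid.{u}) : Type (u + 1) :=
  _root_.Quotient (isIsomorphicSetoid (PrincipalBibundle G H))

/-- The Hilsum--Skandalis map represented by a principal bibundle. -/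
def HSMap.mk {G H : OpenGroupoid.{u}} {X : Locale.{u}} (S : BilocaleStr G H X)
    (hS : S.IsPrincipal) : HSMap H G :=
  _root_.Quotient.mk (isIsomorphicSetoid (PrincipalBibundle G H)) ⟨⟨X, S⟩, hS⟩

-- Arguments with points are imitated by generalized elements `Z ⟶ X`. The obstacle is that a
-- coequalizer of locales need not be preserved by pullback, so actions on `X ⊗_H X'` cannot be read
-- off from the coequalizer alone. Open surjections repair this: they are stable under pullback
-- (`IsOpenSurj.of_isPullback`) and are the coequalizers of their kernel pairs
-- (`IsOpenSurj.exists_desc`). Hence maps can be defined, and equations checked, locally on a cover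
-- by an open surjection (`exists_of_rel`, `isIso_of_mono_of_local`).
--
-- The main point is therefore that `(x, x') ↦ x ⊗ x'` is an open surjection. For principal `X'`,
-- two points `e`, `x'` with `q e = q x'` satisfy `x' = h e` for a unique `h`, and `(x, h e) ↦ (x h,
-- e)` is a descent datum on `X ×_{H₀} X'` along the open surjection `q : X' ⟶ K₀`. Its quotient is
-- `X ⊗_H X'`. The theorem `descent` shows that the quotient map is an open surjection and that `X
-- ×_{H₀} X'` is the pullback `X' ×_{K₀} (X ⊗_H X')`; see `tensor_descent`. It follows that every
-- element of the tensor product is locally a pure tensor, and that `x ⊗ x' = y ⊗ x'` forces `x =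
-- y`.
--
-- After this the usual pointwise proofs apply: the induced structure exists and is unique, and it
-- is principal because free and locally transitive actions suffice
-- (`IsPrincipalBundle.of_free_of_local`). Since every map of principal bibundles is invertible
-- (`Bilocale.Hom.isIso_f`), the category laws need only one equivariant map each: `x ⊗ h ↦ x h`, `g
-- ⊗ x ↦ g x` and `(x ⊗ x') ⊗ x'' ↦ x ⊗ (x' ⊗ x'')`.

attribute [local simp] pullback.lift_fst pullback.lift_snd pullback.lift_fst_assoc
  pullback.lift_snd_assoc

/-! ### Direct images along projections of pullbacks, in terms of frames. -/

namespace FrameLimits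

variable {A B C : Type u} [Order.Frame A] [Order.Frame B] [Order.Frame C]
  {f : FrameHom C A} {l : A → C}

/-- The right adjoint of the direct image along the second projection of a pullback of locales. -/
def directAdj (g : FrameHom C B) (hl : GaloisConnection l f)
    (hF : ∀ a c, l (a ⊓ f c) = l a ⊓ c) (z : B) : pushoutSublocale f g :=
  ⟨⟨{x | g (l x.1) ⊓ x.2 ≤ z}, fun x y hyx hx =>
    (inf_le_inf (OrderHomClass.mono g (hl.monotone_l hyx.1)) hyx.2).trans hx⟩, by
    refine ⟨fun s b hs => ?_, fun a t ht => ?_, fun a b c => ?_⟩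
    · change g (l (sSup s)) ⊓ b ≤ z
      rw [hl.l_sSup, map_iSup₂, iSup₂_inf_eq]
      exact iSup₂_le hs
    · change g (l a) ⊓ sSup t ≤ z
      rw [inf_sSup_eq]
      exact iSup₂_le ht
    · change g (l (a ⊓ f c)) ⊓ b ≤ z ↔ g (l a) ⊓ (b ⊓ g c) ≤ z
      rw [hF, map_inf, inf_assoc, inf_comm b]⟩

/-- The direct image along the second projection of a pullback of locales. -/
def direct (g : FrameHom C B) (l : A → C) (D : pushoutSublocale f g) : B :=
  ⨆ x ∈ D.1, g (l x.1) ⊓ x.2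

/-- Balancing does the work: since `x ≤ f (l x)`, the rectangle `(x, y)` may be replaced by `(x, y ⊓
g (l x))`, which lies below `(⊤, z)` exactly when it should. Thus `inr` has `direct` as left
adjoint. -/
lemma directAdj_eq (g : FrameHom C B) (hl : GaloisConnection l f)
    (hF : ∀ a c, l (a ⊓ f c) = l a ⊓ c) (z : B) : directAdj g hl hF z = inr f g z := by
  apply le_antisymm
  · rintro ⟨x, y⟩ (h : g (l x) ⊓ y ≤ z)
    have h₁ : (⊤, z) ∈ (tmul f g ⊤ z).1 := (tmul_le f g).1 le_rfl
    have h₂ : (x, y ⊓ g (l x)) ∈ (tmul f g ⊤ z).1 :=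
      lower_mem h₁ le_top (by rwa [inf_comm])
    have h₃ := ((tmul f g ⊤ z).2.2.2 x y (l x)).2 h₂
    rwa [inf_eq_left.2 (hl.le_u_l x)] at h₃
  · exact (tmul_le f g).2 inf_le_right

lemma direct_gc (g : FrameHom C B) (hl : GaloisConnection l f)
    (hF : ∀ a c, l (a ⊓ f c) = l a ⊓ c) :
    GaloisConnection (direct g l : pushoutSublocale f g → B) (inr f g) := by
  intro D z
  rw [← directAdj_eq g hl hF, direct, iSup₂_le_iff]
  rfl

lemma direct_tmul (g : FrameHom C B) (hl : GaloisConnection l f)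
    (hF : ∀ a c, l (a ⊓ f c) = l a ⊓ c) (a : A) (b : B) :
    direct g l (tmul f g a b) = g (l a) ⊓ b := by
  refine eq_of_forall_ge_iff fun z => ?_
  rw [direct_gc g hl hF _ _, tmul_le, ← directAdj_eq g hl hF]
  rfl

lemma direct_inf_inr (g : FrameHom C B) (hl : GaloisConnection l f)
    (hF : ∀ a c, l (a ⊓ f c) = l a ⊓ c) (D : pushoutSublocale f g) (b : B) :
    direct g l (D ⊓ inr f g b) = direct g l D ⊓ b := by
  have gc := direct_gc g hl hF
  apply le_antisymm
  · exact le_inf (gc.monotone_l inf_le_left) (gc.l_le inf_le_right)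
  · rw [direct, iSup₂_inf_eq]
    refine iSup₂_le fun x hx => ?_
    rw [inf_assoc]
    refine le_iSup₂ (f := fun (x : A × B) (_ : x ∈ (D ⊓ inr f g b).1) => g (l x.1) ⊓ x.2)
      (x.1, x.2 ⊓ b) ⟨lower_mem hx le_rfl inf_le_left, ?_⟩
    exact lower_mem ((tmul_le f g).1 le_rfl) le_top inf_le_right

end FrameLimits

/-! ### Open maps and open surjections of locales. -/

namespace Locale

variable {X Y Z W : Locale.{u}}

@[simp]
lemma invImage_id (x : X) : invImage (𝟙 X) x = x := rfl

lemma invImage_comp (f : X ⟶ Y) (g : Y ⟶ Z) (z : Z) :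
    invImage (f ≫ g) z = invImage f (invImage g z) := rfl

lemma hom_ext_invImage {f g : X ⟶ Y} (h : ∀ y, invImage f y = invImage g y) : f = g :=
  Quiver.Hom.unop_inj (Frm.hom_ext (FrameHom.ext h))

/-- The map of locales with a given inverse image homomorphism. -/
def homOfFrameHom (φ : FrameHom Y X) : X ⟶ Y :=
  Quiver.Hom.op (X := Y.unop) (Y := X.unop) (Frm.ofHom φ)

lemma invImage_congr {f g : X ⟶ Y} (h : f = g) (y : Y) : invImage f y = invImage g y := by rw [h]

/-- The comparison of a pullback of locales with the pushout of frames. -/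
lemma exists_comparison {P : Locale.{u}} {fst : P ⟶ X} {snd : P ⟶ Y} {f : X ⟶ Z} {g : Y ⟶ Z}
    (h : IsPullback fst snd f g) :
    ∃ (J : FrameHom P (FrameLimits.pushoutSublocale (invImage f) (invImage g)))
      (K : FrameHom (FrameLimits.pushoutSublocale (invImage f) (invImage g)) P),
      (∀ w, K (J w) = w) ∧ (∀ a, J (invImage fst a) = FrameLimits.inl _ _ a) ∧
      (∀ b, J (invImage snd b) = FrameLimits.inr _ _ b) ∧
      (∀ a, K (FrameLimits.inl _ _ a) = invImage fst a) ∧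
      (∀ b, K (FrameLimits.inr _ _ b) = invImage snd b) := by
  let Q : Locale.{u} := of (FrameLimits.pushoutSublocale (invImage f) (invImage g))
  let i₁ : Q ⟶ X := homOfFrameHom (FrameLimits.inl (invImage f) (invImage g))
  let i₂ : Q ⟶ Y := homOfFrameHom (FrameLimits.inr (invImage f) (invImage g))
  have w : i₁ ≫ f = i₂ ≫ g := hom_ext_invImage fun c =>
    DFunLike.congr_fun (FrameLimits.inl_comp (invImage f) (invImage g)) c
  have w' : (invImage fst).comp (invImage f) = (invImage snd).comp (invImage g) :=
    FrameHom.ext fun c => invImage_congr h.w c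
  let k : P ⟶ Q := homOfFrameHom (FrameLimits.desc (invImage fst) (invImage snd) w')
  have k₁ : k ≫ i₁ = fst := hom_ext_invImage fun a =>
    DFunLike.congr_fun (FrameLimits.desc_inl (invImage fst) (invImage snd) w') a
  have k₂ : k ≫ i₂ = snd := hom_ext_invImage fun a =>
    DFunLike.congr_fun (FrameLimits.desc_inr (invImage fst) (invImage snd) w') a
  have kj : k ≫ h.lift i₁ i₂ w = 𝟙 P := by
    apply h.hom_ext <;> simp [k₁, k₂]
  exact ⟨invImage (h.lift i₁ i₂ w), invImage k, invImage_congr kj,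
    invImage_congr (h.lift_fst i₁ i₂ w), invImage_congr (h.lift_snd i₁ i₂ w),
    invImage_congr k₁, invImage_congr k₂⟩

/-- Every open of a pullback of locales is a join of open rectangles. -/
lemma exists_eq_iSup {P : Locale.{u}} {fst : P ⟶ X} {snd : P ⟶ Y} {f : X ⟶ Z} {g : Y ⟶ Z}
    (h : IsPullback fst snd f g) (w : P) :
    ∃ D : Set (X × Y), w = ⨆ x ∈ D, invImage fst x.1 ⊓ invImage snd x.2 := by
  obtain ⟨J, K, hKJ, -, -, h₁, h₂⟩ := exists_comparison h
  refine ⟨(J w).1, ?_⟩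
  conv_lhs => rw [← hKJ w, FrameLimits.eq_iSup_tmul _ _ (J w)]
  simp only [map_iSup, map_inf, h₁, h₂]
  rfl

/-- The direct image along an open map of locales. -/
noncomputable def direct {f : X ⟶ Y} (hf : IsOpenMap f) : X → Y := hf.choose

lemma direct_gc {f : X ⟶ Y} (hf : IsOpenMap f) : GaloisConnection (direct hf) (invImage f) :=
  hf.choose_spec.1

lemma direct_inf {f : X ⟶ Y} (hf : IsOpenMap f) (a : X) (b : Y) :
    direct hf (a ⊓ invImage f b) = direct hf a ⊓ b :=
  hf.choose_spec.2 a b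

/-- Open maps are stable under pullback, and the Beck-Chevalley condition holds. -/
lemma exists_direct_of_isPullback {P : Locale.{u}} {fst : P ⟶ X} {snd : P ⟶ Y} {f : X ⟶ Z}
    {g : Y ⟶ Z} (h : IsPullback fst snd f g) (hf : IsOpenMap f) :
    ∃ l : P → Y, GaloisConnection l (invImage snd) ∧
      (∀ a b, l (a ⊓ invImage snd b) = l a ⊓ b) ∧
      ∀ a, l (invImage fst a) = invImage g (direct hf a) := by
  obtain ⟨J, K, hKJ, h₁, h₂, h₃, h₄⟩ := exists_comparison h
  have gc := FrameLimits.direct_gc (invImage g) (direct_gc hf) (direct_inf hf)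
  refine ⟨fun w => FrameLimits.direct (invImage g) (direct hf) (J w), fun w b => ?_,
    fun a b => ?_, fun a => ?_⟩
  · rw [gc, ← h₂]
    refine ⟨fun hw => ?_, fun hw => OrderHomClass.mono J hw⟩
    rw [← hKJ w, ← hKJ (invImage snd b)]
    exact OrderHomClass.mono K hw
  · beta_reduce
    rw [map_inf, h₂]
    exact FrameLimits.direct_inf_inr (invImage g) (direct_gc hf) (direct_inf hf) _ _
  · beta_reduce
    rw [h₁]
    refine (FrameLimits.direct_tmul (invImage g) (direct_gc hf) (direct_inf hf) a ⊤).trans ?_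
    rw [inf_top_eq]

lemma IsOpenMap.of_isPullback {P : Locale.{u}} {fst : P ⟶ X} {snd : P ⟶ Y} {f : X ⟶ Z}
    {g : Y ⟶ Z} (h : IsPullback fst snd f g) (hf : IsOpenMap f) : IsOpenMap snd :=
  let ⟨l, h₁, h₂, _⟩ := exists_direct_of_isPullback h hf
  ⟨l, h₁, h₂⟩

/-- The Beck–Chevalley identity does not depend on which direct image is used, because left adjoints
are unique. -/
lemma direct_invImage_of_isPullback {P : Locale.{u}} {fst : P ⟶ X} {snd : P ⟶ Y} {f : X ⟶ Z}
    {g : Y ⟶ Z} (h : IsPullback fst snd f g) (hf : IsOpenMap f) (hs : IsOpenMap snd) (a : X) :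
    direct hs (invImage fst a) = invImage g (direct hf a) := by
  obtain ⟨l, h₁, -, h₃⟩ := exists_direct_of_isPullback h hf
  rw [← h₃]
  exact (direct_gc hs).l_unique h₁ fun _ => rfl

lemma IsOpenMap.comp {f : X ⟶ Y} {g : Y ⟶ Z} (hf : IsOpenMap f) (hg : IsOpenMap g) :
    IsOpenMap (f ≫ g) := by
  refine ⟨fun a => direct hg (direct hf a), (direct_gc hf).compose (direct_gc hg), fun a b => ?_⟩
  beta_reduce
  rw [invImage_comp, direct_inf, direct_inf]

lemma IsSurjection.le_iff {f : X ⟶ Y} (hf : IsSurjection f) {a b : Y} :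
    invImage f a ≤ invImage f b ↔ a ≤ b := by
  rw [← inf_eq_left, ← map_inf, hf.eq_iff, inf_eq_left]

/-- An open surjection of locales. -/
structure IsOpenSurj (f : X ⟶ Y) : Prop where
  isOpenMap : IsOpenMap f
  isSurjection : IsSurjection f

lemma IsSurjection.epi {f : X ⟶ Y} (hf : IsSurjection f) : Epi f where
  left_cancellation _ _ h := hom_ext_invImage fun z => hf (invImage_congr h z)

lemma IsSurjection.of_section {f : X ⟶ Y} {s : Y ⟶ X} (h : s ≫ f = 𝟙 Y) : IsSurjection f :=
  Function.LeftInverse.injective (g := invImage s) (invImage_congr h)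

lemma IsSurjection.of_comp {f : X ⟶ Y} {g : Y ⟶ Z} (h : IsSurjection (f ≫ g)) :
    IsSurjection g :=
  Function.Injective.of_comp (f := invImage f) h

lemma IsOpenMap.of_isIso (f : X ⟶ Y) [IsIso f] : IsOpenMap f := by
  have h₁ := invImage_congr (IsIso.hom_inv_id f)
  have h₂ := invImage_congr (IsIso.inv_hom_id f)
  simp only [invImage_comp, invImage_id] at h₁ h₂
  refine ⟨invImage (inv f), fun a b => ⟨fun h => ?_, fun h => ?_⟩, fun a b => ?_⟩
  · rw [← h₁ a]
    exact OrderHomClass.mono _ h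
  · rw [← h₂ b]
    exact OrderHomClass.mono _ h
  · rw [map_inf, h₂]

lemma direct_invImage {f : X ⟶ Y} (hf : IsOpenSurj f) (b : Y) :
    direct hf.isOpenMap (invImage f b) = b := by
  refine le_antisymm ((direct_gc _).l_u_le b) (hf.isSurjection.le_iff.1 ?_)
  exact (direct_gc hf.isOpenMap).le_u_l _

lemma direct_top {f : X ⟶ Y} (hf : IsOpenSurj f) : direct hf.isOpenMap ⊤ = ⊤ := by
  rw [← map_top (invImage f), direct_invImage hf]

namespace IsOpenSurj

lemma epi {f : X ⟶ Y} (hf : IsOpenSurj f) : Epi f := hf.isSurjection.epi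

lemma comp {f : X ⟶ Y} {g : Y ⟶ Z} (hf : IsOpenSurj f) (hg : IsOpenSurj g) :
    IsOpenSurj (f ≫ g) :=
  ⟨hf.1.comp hg.1, hf.2.comp hg.2⟩

lemma of_isIso (f : X ⟶ Y) [IsIso f] : IsOpenSurj f :=
  ⟨.of_isIso f, .of_section (IsIso.inv_hom_id f)⟩

/-- By Frobenius, `snd_! (snd^* b) = snd_! ⊤ ⊓ b`, and Beck–Chevalley gives `snd_! ⊤ = g^* (f_! ⊤) =
⊤`. -/
lemma of_isPullback {P : Locale.{u}} {fst : P ⟶ X} {snd : P ⟶ Y} {f : X ⟶ Z}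
    {g : Y ⟶ Z} (h : IsPullback fst snd f g) (hf : IsOpenSurj f) : IsOpenSurj snd := by
  have hs := hf.isOpenMap.of_isPullback h
  refine ⟨hs, Function.LeftInverse.injective (g := direct hs) fun b => ?_⟩
  rw [← top_inf_eq (invImage snd b), direct_inf, ← map_top (invImage fst),
    direct_invImage_of_isPullback h hf.isOpenMap, direct_top hf, map_top, top_inf_eq]

lemma snd {f : X ⟶ Z} (hf : IsOpenSurj f) (g : Y ⟶ Z) : IsOpenSurj (pullback.snd f g) :=
  hf.of_isPullback (IsPullback.of_hasPullback f g)

lemma fst (f : X ⟶ Z) {g : Y ⟶ Z} (hg : IsOpenSurj g) : IsOpenSurj (pullback.fst f g) :=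
  hg.of_isPullback (IsPullback.of_hasPullback f g).flip

/-- If `e ≫ p` is an open surjection and `e` is a surjection, then `p` is an open surjection. -/
lemma of_comp {e : X ⟶ Y} {p : Y ⟶ Z} (h : IsOpenSurj (e ≫ p)) (he : IsSurjection e) :
    IsOpenSurj p := by
  refine ⟨⟨fun y => direct h.isOpenMap (invImage e y), fun a b => ?_, fun a b => ?_⟩,
    h.isSurjection.of_comp⟩
  · rw [direct_gc h.isOpenMap _ _, invImage_comp, he.le_iff]
  · beta_reduce
    rw [map_inf, ← invImage_comp, direct_inf]

end IsOpenSurj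

/-- A surjection `e` identifies the frame of `Y` with a subframe of that of `X`, so factoring
through `e` is a condition on the opens `c^* z` only. -/
lemma exists_factor {e : X ⟶ Y} (he : IsSurjection e) (c : X ⟶ Z)
    (h : ∀ z, invImage c z ∈ Set.range (invImage e)) : ∃ j : Y ⟶ Z, e ≫ j = c := by
  choose k hk using h
  refine ⟨homOfFrameHom
    { toFun := k
      map_inf' := fun a b => he (by rw [hk, map_inf, map_inf, hk, hk])
      map_top' := he (by rw [hk, map_top, map_top])
      map_sSup' := fun S => he (by
        rw [hk, map_sSup, map_sSup, Set.image_image]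
        simp only [hk]) }, hom_ext_invImage hk⟩

/-- An open surjection of locales is the coequalizer of its kernel pair. -/
lemma IsOpenSurj.exists_desc {e : X ⟶ Y} (he : IsOpenSurj e) (c : X ⟶ Z)
    (h : ∀ {W : Locale.{u}} (a b : W ⟶ X), a ≫ e = b ≫ e → a ≫ c = b ≫ c) :
    ∃ j : Y ⟶ Z, e ≫ j = c := by
  -- With `s` and `s'` the second and first kernel-pair projections, `e^* e_! c^* z = s_! s'^* c^* z
  -- = s_! s^* c^* z = c^* z`.
  refine exists_factor he.isSurjection c fun z => ⟨direct he.isOpenMap (invImage c z), ?_⟩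
  have hs := he.snd e
  rw [← direct_invImage_of_isPullback (.of_hasPullback e e) he.isOpenMap hs.isOpenMap,
    ← invImage_comp, h _ _ pullback.condition, invImage_comp, direct_invImage hs]

/-- The coequalizer is computed by the subframe `Equ` of opens with equal inverse images; `j`
compares it with the chosen coequalizer and has a section. -/
lemma coequalizer_isSurjection_and_range (f g : X ⟶ Y) :
    IsSurjection (coequalizer.π f g) ∧
      ∀ y, invImage f y = invImage g y → y ∈ Set.range (invImage (coequalizer.π f g)) := by
  let Q : Locale.{u} := of (FrameLimits.Equ (invImage f) (invImage g))
  let i : Y ⟶ Q := homOfFrameHom (FrameLimits.Equ.incl (invImage f) (invImage g))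
  have hi : f ≫ i = g ≫ i := hom_ext_invImage fun z => z.2
  let j : Q ⟶ coequalizer f g := homOfFrameHom (FrameLimits.Equ.lift
    (invImage (coequalizer.π f g)) (FrameHom.ext fun z =>
      invImage_congr (coequalizer.condition f g) z))
  have hj : i ≫ j = coequalizer.π f g := hom_ext_invImage fun z => rfl
  have h₁ : coequalizer.π f g ≫ coequalizer.desc i hi = i := coequalizer.π_desc i hi
  have h₂ : coequalizer.desc i hi ≫ j = 𝟙 _ := by
    apply coequalizer.hom_ext
    rw [reassoc_of% h₁, hj, Category.comp_id]
  refine ⟨?_, fun y hy => ⟨invImage (coequalizer.desc i hi) ⟨y, hy⟩, ?_⟩⟩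
  · rw [← hj]
    exact Function.Injective.comp (g := invImage i) Subtype.val_injective
      (IsSurjection.of_section h₂)
  · exact invImage_congr h₁ _

end Locale

/-! ### Constructions local for open surjections, and descent. -/

namespace Locale

variable {X Y Z W : Locale.{u}}

/-- Maps of locales out of `B` can be defined on an open cover by a functional relation between
generalized elements that is stable under precomposition. -/
lemma exists_of_rel {B : Locale.{u}} (Rel : ∀ {Z : Locale.{u}}, (Z ⟶ B) → (Z ⟶ W) → Prop)
    (comp : ∀ {Z Z' : Locale.{u}} (f : Z' ⟶ Z) (b : Z ⟶ B) (w : Z ⟶ W),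
      Rel b w → Rel (f ≫ b) (f ≫ w))
    (unique : ∀ {Z : Locale.{u}} (b : Z ⟶ B) (w w' : Z ⟶ W), Rel b w → Rel b w' → w = w')
    (exist : ∃ (Z : Locale.{u}) (ζ : Z ⟶ B) (w : Z ⟶ W), IsOpenSurj ζ ∧ Rel ζ w) :
    ∃ k : B ⟶ W, ∀ {Z : Locale.{u}} (b : Z ⟶ B) (w : Z ⟶ W), Rel b w → b ≫ k = w := by
  obtain ⟨A, ζ, v, hζ, hv⟩ := exist
  obtain ⟨k, hk⟩ := hζ.exists_desc v fun a b h =>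
    unique (a ≫ ζ) _ _ (comp a ζ v hv) (h ▸ comp b ζ v hv)
  refine ⟨k, fun {Z} b w h => ?_⟩
  -- The cover `ζ` is pulled back along `b`; there both candidates are related to the same element
  -- of `B`.
  have := (IsOpenSurj.fst b hζ).epi
  rw [← cancel_epi (pullback.fst b ζ)]
  rw [pullback.condition_assoc, hk]
  exact unique (pullback.snd b ζ ≫ ζ) _ _ (comp _ _ _ hv) (by
    rw [← pullback.condition]
    exact comp _ _ _ h)

/-- A monomorphism of locales that has sections locally for an open cover is an isomorphism. -/
lemma isIso_of_mono_of_local {A B : Locale.{u}} (f : A ⟶ B)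
    (mono : ∀ {Z : Locale.{u}} (a b : Z ⟶ A), a ≫ f = b ≫ f → a = b)
    (exist : ∃ (Z : Locale.{u}) (ζ : Z ⟶ B) (s : Z ⟶ A), IsOpenSurj ζ ∧ s ≫ f = ζ) :
    IsIso f := by
  obtain ⟨k, hk⟩ := exists_of_rel (B := B) (W := A) (fun b a => a ≫ f = b)
    (fun f b w h => by simp [h]) (fun b w w' h h' => mono _ _ (h.trans h'.symm)) exist
  have h := hk f (𝟙 A) (Category.id_comp f)
  exact ⟨k, h, mono _ _ (by simp [h]) |> fun h' : f ≫ k = 𝟙 A => by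
    obtain ⟨Z, ζ, s, hζ, rfl⟩ := exist
    have := hζ.epi
    rw [← cancel_epi (s ≫ f)]
    simp [reassoc_of% h']⟩

section Descent

variable {E B Q : Locale.{u}} {π : E ⟶ B} {φ : Y ⟶ E} {a : pullback π (φ ≫ π) ⟶ Y} {τ : Y ⟶ Q}
  {ρ : Q ⟶ B}

/-- Descent along an open surjection `π : E ⟶ B`: if `a : E ×_B Y ⟶ Y` is a descent datum on
`φ : Y ⟶ E` and `τ : Y ⟶ Q` is the quotient of `Y` by it, then `τ` is an open surjection and
`Y` is the pullback `E ×_B Q`. -/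
theorem descent (hπ : IsOpenSurj π) (aφ : a ≫ φ = pullback.fst π (φ ≫ π))
    (a_one : pullback.lift φ (𝟙 Y) (by simp) ≫ a = 𝟙 Y)
    (a_assoc : ∀ {Z : Locale.{u}} (e e' : Z ⟶ E) (y : Z ⟶ Y) (w : e ≫ π = e' ≫ π)
      (w' : e' ≫ π = y ≫ φ ≫ π),
      pullback.lift e (pullback.lift e' y w' ≫ a) (by simp [reassoc_of% aφ, w]) ≫ a =
        pullback.lift e y (w.trans w') ≫ a)
    (aτ : a ≫ τ = pullback.snd π (φ ≫ π) ≫ τ) (τ_surj : IsSurjection τ)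
    (τ_range : ∀ y, invImage a y = invImage (pullback.snd π (φ ≫ π)) y →
      y ∈ Set.range (invImage τ))
    (τρ : τ ≫ ρ = φ ≫ π) :
    IsOpenSurj τ ∧ IsPullback φ τ π ρ := by
  set s := pullback.snd π (φ ≫ π) with hs
  have s_os : IsOpenSurj s := hπ.snd _
  have a_surj : IsSurjection a := .of_section a_one
  -- the locale of triples `(e, e', y)`, as composable pairs
  let n : pullback s a ⟶ pullback π (φ ≫ π) := pullback.snd s a
  let t : pullback s a ⟶ pullback π (φ ≫ π) := pullback.fst s a
  have w₁ : (t ≫ pullback.fst π (φ ≫ π)) ≫ π = (n ≫ pullback.fst π (φ ≫ π)) ≫ π := by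
    rw [Category.assoc, pullback.condition, ← hs, pullback.condition_assoc, reassoc_of% aφ,
      Category.assoc]
  have w₂ : (t ≫ pullback.fst π (φ ≫ π)) ≫ π = (n ≫ s) ≫ φ ≫ π := by
    rw [w₁, Category.assoc, Category.assoc, pullback.condition]
  let m : pullback s a ⟶ pullback π (φ ≫ π) :=
    pullback.lift (t ≫ pullback.fst π (φ ≫ π)) (n ≫ s) w₂
  have m_fst : m ≫ pullback.fst π (φ ≫ π) = t ≫ pullback.fst π (φ ≫ π) :=
    pullback.lift_fst _ _ _
  have m_s : m ≫ s = n ≫ s := pullback.lift_snd _ _ _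
  have t_s : t ≫ s = n ≫ a := pullback.condition
  have t_a : t ≫ a = m ≫ a := by
    have := a_assoc (t ≫ pullback.fst π (φ ≫ π)) (n ≫ pullback.fst π (φ ≫ π)) (n ≫ s)
      w₁ (w₁.symm.trans w₂)
    refine Eq.trans ?_ this
    congr 1
    apply pullback.hom_ext
    · simp
    · rw [pullback.lift_snd, ← hs, t_s]
      congr 1
      apply pullback.hom_ext <;> simp [hs]
  -- The pairs `(e, y)` are the arrows of a groupoid on `Y` with source `s` and target `a`, and `m`
  -- is the composite of `n` followed by `t`. As `t` can be recovered from `n` and `m`, composable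
  -- pairs are the same as pairs of arrows with a common source.
  have sq : IsPullback n m s s := by
    refine IsPullback.mk' m_s.symm (fun T b c h₁ h₂ => ?_) fun T b c h => ?_
    · apply pullback.hom_ext _ h₁
      apply pullback.hom_ext
      · simpa only [Category.assoc, m_fst] using h₂ =≫ pullback.fst π (φ ≫ π)
      · simpa only [Category.assoc, ← t_s] using h₁ =≫ a
    · have hc := pullback.condition (f := π) (g := φ ≫ π)
      let c' : T ⟶ pullback π (φ ≫ π) := pullback.lift (c ≫ pullback.fst _ _) (b ≫ a) (by
        rw [Category.assoc, hc, ← hs, ← reassoc_of% h, Category.assoc, reassoc_of% aφ, hc])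
      have hc' : c' ≫ s = b ≫ a := pullback.lift_snd _ _ _
      refine ⟨pullback.lift c' b hc', pullback.lift_snd _ _ _, ?_⟩
      apply pullback.hom_ext
      · simp [m_fst, t, c']
      · rw [← hs, Category.assoc, m_s, pullback.lift_snd_assoc, h]
  have sq' : IsPullback m n s s := sq.flip
  have n_os : IsOpenSurj n := s_os.of_isPullback sq'
  have m_os : IsOpenSurj m := s_os.of_isPullback sq
  -- The saturation `s_! a^* y` is invariant: Beck–Chevalley for the two squares gives `a^* s_! a^*
  -- y = n_! t^* a^* y = n_! m^* a^* y = s^* s_! a^* y`. So it is `τ^* (l y)`, and `l` is the direct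
  -- image along `τ`.
  have key : ∀ y, direct s_os.1 (invImage a y) ∈ Set.range (invImage τ) := fun y => by
    apply τ_range
    rw [← direct_invImage_of_isPullback (.of_hasPullback s a) s_os.1 n_os.1, ← invImage_comp,
      t_a, invImage_comp, direct_invImage_of_isPullback sq' s_os.1 n_os.1]
  choose l hl using key
  have τ_os : IsOpenSurj τ := by
    refine ⟨⟨l, fun y q => ?_, fun y q => τ_surj ?_⟩, τ_surj⟩
    · rw [← τ_surj.le_iff, hl, direct_gc s_os.1 _ _, ← invImage_comp, ← aτ, invImage_comp,
        a_surj.le_iff]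
    · rw [hl, map_inf, map_inf, hl, ← direct_inf s_os.1, ← invImage_comp, ← invImage_comp, aτ]
  refine ⟨τ_os, ?_⟩
  -- The map `(e, y) ↦ (e, τ y)` is a pullback of `τ`, hence an open surjection. The inverse of `(φ,
  -- τ) : Y ⟶ E ×_B Q` is obtained by factoring `a` through it.
  let e : pullback π (φ ≫ π) ⟶ pullback π ρ :=
    pullback.lift (pullback.fst _ _) (s ≫ τ) (by rw [Category.assoc, τρ, pullback.condition])
  have e_fst : e ≫ pullback.fst π ρ = pullback.fst π (φ ≫ π) := pullback.lift_fst _ _ _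
  have e_snd : e ≫ pullback.snd π ρ = s ≫ τ := pullback.lift_snd _ _ _
  have e_sq : IsPullback s e τ (pullback.snd π ρ) := by
    refine IsPullback.mk' e_snd.symm (fun T b c h₁ h₂ => ?_) fun T b c h => ?_
    · apply pullback.hom_ext _ h₁
      simpa only [Category.assoc, e_fst] using h₂ =≫ pullback.fst π ρ
    · let l : T ⟶ pullback π (φ ≫ π) := pullback.lift (c ≫ pullback.fst _ _) b (by
        rw [← τρ, reassoc_of% h, Category.assoc, pullback.condition])
      have hl : l ≫ s = b := pullback.lift_snd _ _ _
      refine ⟨l, hl, ?_⟩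
      apply pullback.hom_ext
      · simp [e_fst, l]
      · rw [Category.assoc, e_snd, reassoc_of% hl, h]
  have e_os : IsOpenSurj e := τ_os.of_isPullback e_sq
  have te : t ≫ e = m ≫ e := by
    apply pullback.hom_ext
    · simp [e_fst, m_fst]
    · simp [e_snd, reassoc_of% t_s, reassoc_of% m_s, aτ]
  obtain ⟨j, hj⟩ : ∃ j, e ≫ j = a := by
    refine exists_factor e_os.2 a fun z => ?_
    obtain ⟨D, hD⟩ := exists_eq_iSup e_sq (invImage a z)
    -- Write `a^* z` as a join of `s^* y ⊓ e^* w` and apply `m_! t^*`, which fixes `a^* z` because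
    -- `t ≫ a = m ≫ a`. Frobenius and `t ≫ e = m ≫ e` pull out `e^* w`, while `s^* y` becomes `m_!
    -- n^* a^* y = s^* s_! a^* y = s^* τ^* (l y)`, an open coming from `E ×_B Q`.
    refine ⟨⨆ x ∈ D, invImage (pullback.snd π ρ) (l x.1) ⊓ x.2, ?_⟩
    rw [← direct_invImage m_os (invImage a z), ← invImage_comp, ← t_a, invImage_comp, hD]
    simp only [map_iSup, (direct_gc m_os.1).l_iSup, map_inf]
    refine biSup_congr fun x hx => ?_
    rw [← invImage_comp, ← invImage_comp t, ← invImage_comp t, te, e_snd, t_s,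
      invImage_comp m e, direct_inf, invImage_comp n, direct_invImage_of_isPullback sq s_os.1,
      ← hl, invImage_comp s]
  let k : Y ⟶ pullback π ρ := pullback.lift φ τ τρ.symm
  have hk : pullback.lift φ (𝟙 Y) (by simp) ≫ e = k := by
    apply pullback.hom_ext
    · simp [e_fst, k]
    · simp [e_snd, k, hs]
  have hkj : k ≫ j = 𝟙 Y := by rw [← hk, Category.assoc, hj, a_one]
  have hjk : j ≫ k = 𝟙 _ := by
    have := e_os.epi
    rw [← cancel_epi e, reassoc_of% hj, Category.comp_id]
    apply pullback.hom_ext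
    · simp [k, aφ, e_fst]
    · simp [k, aτ, e_snd]
  exact IsPullback.of_iso_pullback ⟨τρ.symm⟩ ⟨k, j, hkj, hjk⟩ (pullback.lift_fst _ _ _)
    (pullback.lift_snd _ _ _)

end Descent

end Locale

/-! ### Groupoids and actions in terms of generalized elements. -/

open Locale

/-- The product of generalized elements of the locale of arrows of a groupoid. -/
noncomputable def OpenGroupoid.mul (G : OpenGroupoid.{u}) {Z : Locale.{u}} (g h : Z ⟶ G.G₁)
    (w : g ≫ G.r = h ≫ G.d) : Z ⟶ G.G₁ :=
  pullback.lift g h w ≫ G.m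

namespace OpenGroupoid

variable {G : OpenGroupoid.{u}} {Z Z' : Locale.{u}}

@[simp]
lemma mul_d (g h : Z ⟶ G.G₁) (w : g ≫ G.r = h ≫ G.d) : G.mul g h w ≫ G.d = g ≫ G.d := by
  simp [mul, G.m_d]

@[simp]
lemma mul_r (g h : Z ⟶ G.G₁) (w : g ≫ G.r = h ≫ G.d) : G.mul g h w ≫ G.r = h ≫ G.r := by
  simp [mul, G.m_r]

lemma comp_mul (f : Z' ⟶ Z) (g h : Z ⟶ G.G₁) (w : g ≫ G.r = h ≫ G.d) :
    f ≫ G.mul g h w = G.mul (f ≫ g) (f ≫ h) (by simp [w]) := by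
  rw [mul, mul, ← Category.assoc]
  congr 1
  apply pullback.hom_ext <;> simp

lemma mul_mul (f g h : Z ⟶ G.G₁) (w₁ : f ≫ G.r = g ≫ G.d) (w₂ : g ≫ G.r = h ≫ G.d) :
    G.mul (G.mul f g w₁) h (by simp [w₂]) = G.mul f (G.mul g h w₂) (by simp [w₁]) :=
  G.mul_assoc f g h w₁ w₂

lemma unit_mul (g : Z ⟶ G.G₁) : G.mul (g ≫ G.d ≫ G.u) g (by simp [G.u_r]) = g := by
  have := (Category.assoc _ _ _).trans ((g ≫= G.one_mul).trans (Category.comp_id g))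
  refine Eq.trans ?_ this
  rw [mul]
  congr 1
  apply pullback.hom_ext <;> simp

lemma mul_unit (g : Z ⟶ G.G₁) : G.mul g (g ≫ G.r ≫ G.u) (by simp [G.u_d]) = g := by
  have := (Category.assoc _ _ _).trans ((g ≫= G.mul_one).trans (Category.comp_id g))
  refine Eq.trans ?_ this
  rw [mul]
  congr 1
  apply pullback.hom_ext <;> simp

lemma inv_mul_self (g : Z ⟶ G.G₁) : G.mul (g ≫ G.i) g (by simp [G.i_r]) = g ≫ G.r ≫ G.u := by
  have := (Category.assoc _ _ _).trans (g ≫= G.inv_mul)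
  refine Eq.trans ?_ this
  rw [mul]
  congr 1
  apply pullback.hom_ext <;> simp

lemma mul_inv_self (g : Z ⟶ G.G₁) : G.mul g (g ≫ G.i) (by simp [G.i_d]) = g ≫ G.d ≫ G.u := by
  have := (Category.assoc _ _ _).trans (g ≫= G.mul_inv)
  refine Eq.trans ?_ this
  rw [mul]
  congr 1
  apply pullback.hom_ext <;> simp

end OpenGroupoid

namespace LeftAction

variable {G : OpenGroupoid.{u}} {X M Z Z' : Locale.{u}} (S : LeftAction G X)

/-- The left action on generalized elements. -/
noncomputable def smul (g : Z ⟶ G.G₁) (x : Z ⟶ X) (w : g ≫ G.r = x ≫ S.p) : Z ⟶ X :=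
  pullback.lift g x w ≫ S.act

variable {S}

@[simp]
lemma smul_p (g : Z ⟶ G.G₁) (x : Z ⟶ X) (w : g ≫ G.r = x ≫ S.p) :
    S.smul g x w ≫ S.p = g ≫ G.d := by
  simp [smul, S.act_p]

lemma comp_smul (f : Z' ⟶ Z) (g : Z ⟶ G.G₁) (x : Z ⟶ X) (w : g ≫ G.r = x ≫ S.p) :
    f ≫ S.smul g x w = S.smul (f ≫ g) (f ≫ x) (by simp [w]) := by
  rw [smul, smul, ← Category.assoc]
  congr 1
  apply pullback.hom_ext <;> simp

lemma mul_smul (g g' : Z ⟶ G.G₁) (x : Z ⟶ X) (w₁ : g ≫ G.r = g' ≫ G.d)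
    (w₂ : g' ≫ G.r = x ≫ S.p) :
    S.smul (G.mul g g' w₁) x (by simp [w₂]) = S.smul g (S.smul g' x w₂) (by simp [w₁]) :=
  S.mul_act g g' x w₁ w₂

lemma one_smul (x : Z ⟶ X) : S.smul (x ≫ S.p ≫ G.u) x (by simp [G.u_r]) = x := by
  have := (Category.assoc _ _ _).trans ((x ≫= S.one_act).trans (Category.comp_id x))
  refine Eq.trans ?_ this
  rw [smul]
  congr 1
  apply pullback.hom_ext <;> simp

namespace IsPrincipalBundle

variable {π : X ⟶ M} (hS : S.IsPrincipalBundle π)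

include hS

lemma isOpenSurj : IsOpenSurj π := ⟨hS.isOpenMap, hS.isSurjection⟩

/-- The pairing map is monic. Together with `exists_smul_eq`, which uses its inverse, this says that
the action is simply transitive on fibres for generalized elements, without passing to a cover. -/
lemma free {g g' : Z ⟶ G.G₁} {x : Z ⟶ X} {w : g ≫ G.r = x ≫ S.p} {w' : g' ≫ G.r = x ≫ S.p}
    (h : S.smul g x w = S.smul g' x w') : g = g' := by
  have := hS.isIso_pairing
  have h' : pullback.lift g x w = pullback.lift g' x w' := by
    rw [← cancel_mono (pullback.lift S.act (pullback.snd G.r S.p) hS.invariant : _ ⟶ pullback π π)]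
    apply pullback.hom_ext
    · simpa [smul] using h
    · simp
  simpa using h' =≫ pullback.fst _ _

lemma exists_smul_eq (x y : Z ⟶ X) (h : x ≫ π = y ≫ π) :
    ∃ (g : Z ⟶ G.G₁) (w : g ≫ G.r = y ≫ S.p), S.smul g y w = x := by
  have := hS.isIso_pairing
  let f : _ ⟶ pullback π π := pullback.lift S.act (pullback.snd G.r S.p) hS.invariant
  let z := pullback.lift x y h ≫ inv f
  have h₁ : z ≫ S.act = x := by
    have : f ≫ pullback.fst π π = S.act := pullback.lift_fst _ _ _
    rw [← this]
    simp [z]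
  have h₂ : z ≫ pullback.snd G.r S.p = y := by
    have : f ≫ pullback.snd π π = pullback.snd _ _ := pullback.lift_snd _ _ _
    rw [← this]
    simp [z]
  have w : (z ≫ pullback.fst G.r S.p) ≫ G.r = y ≫ S.p := by
    rw [← h₂, Category.assoc, Category.assoc z, pullback.condition]
  refine ⟨z ≫ pullback.fst _ _, w, ?_⟩
  rw [← h₁, smul]
  congr 1
  apply pullback.hom_ext <;> simp [h₂]

end IsPrincipalBundle

/-- Principality in terms of generalized elements: the action is free, and locally transitive on
the fibres. -/
lemma IsPrincipalBundle.of_free_of_local {π : X ⟶ M} (invariant : S.act ≫ π = pullback.snd _ _ ≫ π)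
    (hπ : IsOpenSurj π)
    (free : ∀ {Z : Locale.{u}} (g g' : Z ⟶ G.G₁) (x : Z ⟶ X) (w : g ≫ G.r = x ≫ S.p)
      (w' : g' ≫ G.r = x ≫ S.p), S.smul g x w = S.smul g' x w' → g = g')
    (trans : ∀ {Z : Locale.{u}} (x y : Z ⟶ X), x ≫ π = y ≫ π →
      ∃ (Z' : Locale.{u}) (ζ : Z' ⟶ Z) (g : Z' ⟶ G.G₁) (w : g ≫ G.r = (ζ ≫ y) ≫ S.p),
        IsOpenSurj ζ ∧ S.smul g (ζ ≫ y) w = ζ ≫ x) :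
    S.IsPrincipalBundle π := by
  refine ⟨invariant, isIso_of_mono_of_local _ (fun a b h => ?_) ?_, hπ.1, hπ.2⟩
  · have h₁ := h =≫ pullback.fst _ _
    have h₂ := h =≫ pullback.snd _ _
    simp only [Category.assoc, pullback.lift_fst, pullback.lift_snd] at h₁ h₂
    have key : ∀ {Z : Locale.{u}} (c : Z ⟶ pullback G.r S.p), S.smul (c ≫ pullback.fst _ _) (c ≫ pullback.snd _ _)
        (by simp [pullback.condition]) = c ≫ S.act := fun {Z} c => by
      rw [smul]
      congr 1
      apply pullback.hom_ext <;> simp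
    apply pullback.hom_ext _ h₂
    refine free _ _ (a ≫ pullback.snd _ _) (by simp [pullback.condition])
      (by simp [h₂, pullback.condition]) ?_
    rw [key]
    simp only [h₂]
    rw [key, h₁]
  · obtain ⟨Z', ζ, g, w, hζ, h⟩ := trans (pullback.fst π π) (pullback.snd π π) pullback.condition
    refine ⟨Z', ζ, pullback.lift g _ w, hζ, ?_⟩
    apply pullback.hom_ext
    · simpa [smul] using h
    · simp

end LeftAction

namespace RightAction

variable {H : OpenGroupoid.{u}} {X Z Z' : Locale.{u}} (S : RightAction H X)

/-- The right action on generalized elements. -/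
noncomputable def rmul (x : Z ⟶ X) (h : Z ⟶ H.G₁) (w : x ≫ S.q = h ≫ H.d) : Z ⟶ X :=
  pullback.lift x h w ≫ S.ract

variable {S}

@[simp]
lemma rmul_q (x : Z ⟶ X) (h : Z ⟶ H.G₁) (w : x ≫ S.q = h ≫ H.d) :
    S.rmul x h w ≫ S.q = h ≫ H.r := by
  simp [rmul, S.ract_q]

lemma comp_rmul (f : Z' ⟶ Z) (x : Z ⟶ X) (h : Z ⟶ H.G₁) (w : x ≫ S.q = h ≫ H.d) :
    f ≫ S.rmul x h w = S.rmul (f ≫ x) (f ≫ h) (by simp [w]) := by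
  rw [rmul, rmul, ← Category.assoc]
  congr 1
  apply pullback.hom_ext <;> simp

lemma rmul_rmul (x : Z ⟶ X) (h h' : Z ⟶ H.G₁) (w₁ : x ≫ S.q = h ≫ H.d)
    (w₂ : h ≫ H.r = h' ≫ H.d) :
    S.rmul (S.rmul x h w₁) h' (by simp [w₂]) = S.rmul x (H.mul h h' w₂) (by simp [w₁]) :=
  S.ract_mul x h h' w₁ w₂

lemma rmul_one (x : Z ⟶ X) : S.rmul x (x ≫ S.q ≫ H.u) (by simp [H.u_d]) = x := by
  have := (Category.assoc _ _ _).trans ((x ≫= S.ract_one).trans (Category.comp_id x))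
  refine Eq.trans ?_ this
  rw [rmul]
  congr 1
  apply pullback.hom_ext <;> simp

end RightAction

/-! ### The tensor product as a quotient by a descent datum. -/

namespace BilocaleStr

variable {G H K : OpenGroupoid.{u}} {X X' Z Z' : Locale.{u}} {S : BilocaleStr G H X}
  {S' : BilocaleStr H K X'}

@[simp]
lemma smul_q (g : Z ⟶ G.G₁) (x : Z ⟶ X) (w : g ≫ G.r = x ≫ S.p) :
    S.smul g x w ≫ S.q = x ≫ S.q := by
  simp [LeftAction.smul, S.act_q]

@[simp]
lemma rmul_p (x : Z ⟶ X) (h : Z ⟶ H.G₁) (w : x ≫ S.q = h ≫ H.d) :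
    S.rmul x h w ≫ S.p = x ≫ S.p := by
  simp [RightAction.rmul, S.ract_p]

lemma smul_rmul (g : Z ⟶ G.G₁) (x : Z ⟶ X) (h : Z ⟶ H.G₁)
    (w₁ : g ≫ G.r = x ≫ S.p) (w₂ : x ≫ S.q = h ≫ H.d) :
    S.rmul (S.smul g x w₁) h (by simp [w₂]) = S.smul g (S.rmul x h w₂) (by simp [w₁]) :=
  S.act_ract g x h w₁ w₂

/-- A bilocale structure is determined by its anchor maps and its actions on generalized
elements. -/
lemma ext_elements {S T : BilocaleStr G H X} (hp : S.p = T.p) (hq : S.q = T.q)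
    (hact : ∀ {Z : Locale.{u}} (g : Z ⟶ G.G₁) (x : Z ⟶ X) (w : g ≫ G.r = x ≫ S.p),
      S.smul g x w = T.smul g x (hp ▸ w))
    (hract : ∀ {Z : Locale.{u}} (x : Z ⟶ X) (h : Z ⟶ H.G₁) (w : x ≫ S.q = h ≫ H.d),
      S.rmul x h w = T.rmul x h (hq ▸ w)) : S = T := by
  obtain ⟨⟨p, act, _, _, _⟩, ⟨q, ract, _, _, _⟩, _, _, _⟩ := S
  obtain ⟨⟨p', act', _, _, _⟩, ⟨q', ract', _, _, _⟩, _, _, _⟩ := T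
  obtain rfl : p = p' := hp
  obtain rfl : q = q' := hq
  obtain rfl : act = act' := by
    have := hact (pullback.fst _ _) (pullback.snd _ _) pullback.condition
    simpa [LeftAction.smul] using this
  obtain rfl : ract = ract' := by
    have := hract (pullback.fst _ _) (pullback.snd _ _) pullback.condition
    simpa [RightAction.rmul] using this
  rfl

variable (S S') in
/-- The tensor `x ⊗ x'` of generalized elements. -/
noncomputable def tens (x : Z ⟶ X) (x' : Z ⟶ X') (w : x ≫ S.q = x' ≫ S'.p) : Z ⟶ tensor S S' :=
  pullback.lift x x' w ≫ tensorProj S S'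

lemma comp_tens (f : Z' ⟶ Z) (x : Z ⟶ X) (x' : Z ⟶ X') (w : x ≫ S.q = x' ≫ S'.p) :
    f ≫ tens S S' x x' w = tens S S' (f ≫ x) (f ≫ x') (by simp [w]) := by
  rw [tens, tens, ← Category.assoc]
  congr 1
  apply pullback.hom_ext <;> simp

lemma rmul_tens (x : Z ⟶ X) (h : Z ⟶ H.G₁) (x' : Z ⟶ X') (w₁ : x ≫ S.q = h ≫ H.d)
    (w₂ : h ≫ H.r = x' ≫ S'.p) :
    tens S S' (S.rmul x h w₁) x' (by simp [w₂]) = tens S S' x (S'.smul h x' w₂) (by simp [w₁]) := by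
  have := pullback.lift (pullback.lift x h w₁) x' (by simp [w₂]) ≫=
    coequalizer.condition (tensorLeft S S') (tensorRight S S')
  refine Eq.trans (Eq.trans ?_ ((Category.assoc _ _ _).trans (this.trans (Category.assoc _ _ _).symm))) ?_
  · rw [tens]
    congr 1
    apply pullback.hom_ext <;> simp [tensorLeft, RightAction.rmul]
  · rw [tens]
    congr 1
    apply pullback.hom_ext
    · simp [tensorRight]
    · simp only [tensorRight, LeftAction.smul, Category.assoc, pullback.lift_snd]
      refine (Category.assoc _ _ _).symm.trans ?_
      congr 1
      apply pullback.hom_ext <;> simp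

/-- Maps out of the tensor product. -/
lemma exists_tensor_desc {W : Locale.{u}} (f : pullback S.q S'.p ⟶ W)
    (hf : ∀ {Z : Locale.{u}} (x : Z ⟶ X) (h : Z ⟶ H.G₁) (x' : Z ⟶ X') (w₁ : x ≫ S.q = h ≫ H.d)
      (w₂ : h ≫ H.r = x' ≫ S'.p),
      pullback.lift (S.rmul x h w₁) x' (by simp [w₂]) ≫ f =
        pullback.lift x (S'.smul h x' w₂) (by simp [w₁]) ≫ f) :
    ∃ k : tensor S S' ⟶ W, ∀ {Z : Locale.{u}} (x : Z ⟶ X) (x' : Z ⟶ X')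
      (w : x ≫ S.q = x' ≫ S'.p), tens S S' x x' w ≫ k = pullback.lift x x' w ≫ f := by
  have : tensorLeft S S' ≫ f = tensorRight S S' ≫ f := by
    have := hf (Z := pullback (pullback.snd S.q H.d ≫ H.r) S'.p)
      (pullback.fst _ _ ≫ pullback.fst _ _) (pullback.fst _ _ ≫ pullback.snd _ _)
      (pullback.snd _ _) (by simp [pullback.condition]) (by simp [pullback.condition])
    refine Eq.trans (Eq.trans ?_ this) ?_
    · congr 1
      apply pullback.hom_ext
      · simp only [tensorLeft, RightAction.rmul, pullback.lift_fst]
        congr 1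
        apply pullback.hom_ext <;> simp
      · simp [tensorLeft]
    · rfl
  refine ⟨coequalizer.desc f this, fun x x' w => ?_⟩
  exact (Category.assoc _ _ _).trans (_ ≫= coequalizer.π_desc f this)

end BilocaleStr

namespace BilocaleStr

variable {G H K : OpenGroupoid.{u}} {X X' Z Z' : Locale.{u}}

/-- The anchor map `x ⊗ x' ↦ p x` of the tensor product. -/
noncomputable def tensorP (S : BilocaleStr G H X) (S' : BilocaleStr H K X') :
    tensor S S' ⟶ G.G₀ :=
  coequalizer.desc (pullback.fst _ _ ≫ S.p) (by
    simp [tensorLeft, tensorRight, S.ract_p])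

/-- The anchor map `x ⊗ x' ↦ q x'` of the tensor product. -/
noncomputable def tensorQ (S : BilocaleStr G H X) (S' : BilocaleStr H K X') :
    tensor S S' ⟶ K.G₀ :=
  coequalizer.desc (pullback.snd _ _ ≫ S'.q) (by
    simp [tensorLeft, tensorRight, S'.act_q])

variable {S : BilocaleStr G H X} {S' : BilocaleStr H K X'}

lemma tensorProj_tensorP : tensorProj S S' ≫ tensorP S S' = pullback.fst _ _ ≫ S.p :=
  coequalizer.π_desc _ _

lemma tensorProj_tensorQ : tensorProj S S' ≫ tensorQ S S' = pullback.snd _ _ ≫ S'.q :=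
  coequalizer.π_desc _ _

@[simp]
lemma tens_tensorP (x : Z ⟶ X) (x' : Z ⟶ X') (w : x ≫ S.q = x' ≫ S'.p) :
    tens S S' x x' w ≫ tensorP S S' = x ≫ S.p := by
  simp [tens, tensorProj_tensorP]

@[simp]
lemma tens_tensorQ (x : Z ⟶ X) (x' : Z ⟶ X') (w : x ≫ S.q = x' ≫ S'.p) :
    tens S S' x x' w ≫ tensorQ S S' = x' ≫ S'.q := by
  simp [tens, tensorProj_tensorQ]

/-- The quotient map to the tensor product with a principal bibundle is the pullback of the anchor
map of the bibundle. -/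
theorem tensor_descent (hS' : S'.IsPrincipal) :
    IsOpenSurj (tensorProj S S') ∧
      IsPullback (pullback.snd S.q S'.p) (tensorProj S S') S'.q (tensorQ S S') := by
  let D := pullback S'.q (pullback.snd S.q S'.p ≫ S'.q)
  -- On the generic triple `(e, (x, x'))` with `q e = q x'`, principality of `X'` yields the arrow
  -- `h` with `h e = x'`. The descent datum is `(e, (x, x')) ↦ (x h, e)`, and `ha` computes it from
  -- any arrow `k` with `k e = x'`, by freeness.
  obtain ⟨h, w, hh⟩ := hS'.exists_smul_eq
    (pullback.snd S'.q (pullback.snd S.q S'.p ≫ S'.q) ≫ pullback.snd _ _)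
    (pullback.fst S'.q (pullback.snd S.q S'.p ≫ S'.q)) (by simp [pullback.condition])
  have w' : (pullback.snd S'.q (pullback.snd S.q S'.p ≫ S'.q) ≫ pullback.fst _ _) ≫ S.q =
      h ≫ H.d := by
    rw [← S'.smul_p h _ w, hh, Category.assoc, Category.assoc, pullback.condition]
  let a : D ⟶ pullback S.q S'.p := pullback.lift (S.rmul _ h w') (pullback.fst _ _) (by simp [w])
  have ha : ∀ {Z : Locale.{u}} (e x' : Z ⟶ X') (x : Z ⟶ X) (k : Z ⟶ H.G₁)
      (w₁ : x ≫ S.q = x' ≫ S'.p) (w₂ : k ≫ H.r = e ≫ S'.p) (hk : S'.smul k e w₂ = x')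
      (w₃ : e ≫ S'.q = pullback.lift x x' w₁ ≫ pullback.snd S.q S'.p ≫ S'.q)
      (w₄ : x ≫ S.q = k ≫ H.d),
      pullback.lift e (pullback.lift x x' w₁) w₃ ≫ a =
        pullback.lift (S.rmul x k w₄) e (by simp [w₂]) := by
    intro Z e x' x k w₁ w₂ hk w₃ w₄
    have : pullback.lift e (pullback.lift x x' w₁) w₃ ≫ h = k := by
      refine hS'.free (x := e) (w := by simp [w]) (w' := w₂) ?_
      rw [hk]
      have := pullback.lift e (pullback.lift x x' w₁) w₃ ≫= hh
      rw [LeftAction.comp_smul] at this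
      simpa using this
    apply pullback.hom_ext
    · simp only [a, Category.assoc, pullback.lift_fst, RightAction.comp_rmul, this]
      simp
    · simp [a]
  have aφ : a ≫ pullback.snd S.q S'.p = pullback.fst _ _ := pullback.lift_snd _ _ _
  have ha' : ∀ {Z : Locale.{u}} (e : Z ⟶ X') (y : Z ⟶ pullback S.q S'.p) (k : Z ⟶ H.G₁)
      (w₂ : k ≫ H.r = e ≫ S'.p) (hk : S'.smul k e w₂ = y ≫ pullback.snd _ _)
      (w₃ : e ≫ S'.q = y ≫ pullback.snd S.q S'.p ≫ S'.q)
      (w₄ : (y ≫ pullback.fst _ _) ≫ S.q = k ≫ H.d),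
      pullback.lift e y w₃ ≫ a =
        pullback.lift (S.rmul (y ≫ pullback.fst _ _) k w₄) e (by simp [w₂]) := by
    intro Z e y k w₂ hk w₃ w₄
    have hy : y = pullback.lift (y ≫ pullback.fst _ _) (y ≫ pullback.snd S.q S'.p)
        (by simp [pullback.condition]) := by
      apply pullback.hom_ext <;> simp
    rw [← ha e (y ≫ pullback.snd S.q S'.p) (y ≫ pullback.fst _ _) k
      (by simp [pullback.condition]) w₂ hk (by simpa using w₃) w₄]
    congr 2
  have hd : ∀ {Z : Locale.{u}} (e : Z ⟶ X') (y : Z ⟶ pullback S.q S'.p) (k : Z ⟶ H.G₁)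
      (w₂ : k ≫ H.r = e ≫ S'.p) (hk : S'.smul k e w₂ = y ≫ pullback.snd _ _),
      (y ≫ pullback.fst _ _) ≫ S.q = k ≫ H.d := by
    intro Z e y k w₂ hk
    rw [← S'.smul_p k e w₂, hk, Category.assoc, Category.assoc, pullback.condition]
  obtain ⟨hc₁, hc₂⟩ := coequalizer_isSurjection_and_range (tensorLeft S S') (tensorRight S S')
  refine descent (a := a) hS'.isOpenSurj aφ ?_ ?_ ?_ hc₁ (fun y hy => hc₂ y ?_) tensorProj_tensorQ
  · have hk : S'.smul (pullback.snd S.q S'.p ≫ S'.p ≫ H.u) (pullback.snd S.q S'.p)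
        (by simp [H.u_r]) = 𝟙 _ ≫ pullback.snd S.q S'.p := by
      rw [S'.one_smul, Category.id_comp]
    rw [ha' _ _ _ _ hk _ (hd _ _ _ _ hk)]
    apply pullback.hom_ext
    · have := S.rmul_one (pullback.fst S.q S'.p)
      simpa [pullback.condition_assoc] using this
    · simp
  · intro Z e e' y w₁ w₂
    obtain ⟨k, w₃, hk⟩ := hS'.exists_smul_eq (y ≫ pullback.snd _ _) e' (by simp [w₂])
    obtain ⟨k', w₄, hk'⟩ := hS'.exists_smul_eq e' e w₁.symm
    have hd₁ := hd _ _ _ w₃ hk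
    have e₁ := ha' e' y k w₃ hk w₂ hd₁
    have w₅ : k ≫ H.r = k' ≫ H.d := by rw [w₃, ← hk', S'.smul_p]
    have hk'' : S'.smul (H.mul k k' w₅) e (by simp [w₄]) = y ≫ pullback.snd _ _ := by
      rw [S'.mul_smul _ _ _ _ w₄, ← hk]
      congr 1
    have hkz : S'.smul k' e w₄ = (pullback.lift e' y w₂ ≫ a) ≫ pullback.snd _ _ := by
      rw [hk', e₁, pullback.lift_snd]
    rw [ha' e _ k' w₄ hkz _ (hd _ _ _ _ hkz), ha' e _ (H.mul k k' w₅) _ hk'' _ (hd _ _ _ _ hk'')]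
    apply pullback.hom_ext
    · simp only [pullback.lift_fst, e₁]
      exact S.rmul_rmul _ _ _ _ _
    · simp
  · have e₁ : a ≫ tensorProj S S' = tens S S' (S.rmul _ h w') (pullback.fst _ _) (by simp [w]) := rfl
    rw [e₁, rmul_tens _ _ _ _ w, tens]
    congr 1
    apply pullback.hom_ext <;> simp [hh]
  · let R := pullback (pullback.snd S.q H.d ≫ H.r) S'.p
    -- The map `(x, h, x') ↦ (x', (x, h x'))` carries the two maps defining the tensor product to
    -- the projection and the descent datum, so opens invariant under the datum come from the
    -- coequalizer.
    let σ : R ⟶ D := pullback.lift (pullback.snd _ _) (tensorRight S S') (by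
      simp [tensorRight, S'.act_q])
    have h₁ : σ ≫ pullback.snd _ _ = tensorRight S S' := pullback.lift_snd _ _ _
    have hk : S'.smul (pullback.fst _ _ ≫ pullback.snd _ _)
        (pullback.snd (pullback.snd S.q H.d ≫ H.r) S'.p) (by simp [pullback.condition]) =
        tensorRight S S' ≫ pullback.snd _ _ := by
      simp [LeftAction.smul, tensorRight]
    have h₂ : σ ≫ a = tensorLeft S S' := by
      rw [ha' _ _ _ _ hk _ (hd _ _ _ _ hk)]
      apply pullback.hom_ext
      · simp only [tensorLeft, tensorRight, pullback.lift_fst, RightAction.rmul]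
        congr 1
        apply pullback.hom_ext <;> simp
      · simp [tensorLeft]
    rw [← h₁, ← h₂, invImage_comp, hy, invImage_comp]

/-- Every generalized element of the tensor product is locally of the form `x ⊗ x'`. -/
lemma exists_tens_eq (hS' : S'.IsPrincipal) (t : Z ⟶ tensor S S') :
    ∃ (Z' : Locale.{u}) (ζ : Z' ⟶ Z) (x : Z' ⟶ X) (x' : Z' ⟶ X') (w : x ≫ S.q = x' ≫ S'.p),
      IsOpenSurj ζ ∧ ζ ≫ t = tens S S' x x' w := by
  refine ⟨_, pullback.fst t (tensorProj S S'), pullback.snd t (tensorProj S S') ≫ pullback.fst _ _,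
    pullback.snd t (tensorProj S S') ≫ pullback.snd _ _, by simp [pullback.condition],
    .fst _ (tensor_descent hS').1, ?_⟩
  rw [pullback.condition, tens]
  congr 1
  apply pullback.hom_ext <;> simp

/-- By the pullback square of `tensor_descent`, the pair `(x, x')` is determined by `x'` and `x ⊗
x'`. -/
lemma tens_left_cancel (hS' : S'.IsPrincipal) {x y : Z ⟶ X} {x' : Z ⟶ X'}
    {w : x ≫ S.q = x' ≫ S'.p} {w' : y ≫ S.q = x' ≫ S'.p}
    (h : tens S S' x x' w = tens S S' y x' w') : x = y := by
  have : pullback.lift x x' w = pullback.lift y x' w' :=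
    (tensor_descent hS').2.hom_ext (by simp) h
  simpa using this =≫ pullback.fst _ _

lemma q_eq_of_tens_eq {x y : Z ⟶ X} {x' y' : Z ⟶ X'}
    {w : x ≫ S.q = x' ≫ S'.p} {w' : y ≫ S.q = y' ≫ S'.p}
    (h : tens S S' x x' w = tens S S' y y' w') : x' ≫ S'.q = y' ≫ S'.q := by
  simpa using h =≫ tensorQ S S'

/-- Tensors with the same `q` have representatives with the same second component. -/
lemma exists_tens_eq_right (hS' : S'.IsPrincipal) (x : Z ⟶ X) (x' y' : Z ⟶ X')
    (w : x ≫ S.q = x' ≫ S'.p) (h : x' ≫ S'.q = y' ≫ S'.q) :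
    ∃ (y : Z ⟶ X) (w' : y ≫ S.q = y' ≫ S'.p), tens S S' x x' w = tens S S' y y' w' := by
  obtain ⟨k, w₁, hk⟩ := hS'.exists_smul_eq x' y' h
  have w₂ : x ≫ S.q = k ≫ H.d := by rw [w, ← hk, S'.smul_p]
  refine ⟨S.rmul x k w₂, by simp [w₁], ?_⟩
  rw [rmul_tens _ _ _ _ w₁]
  congr 1
  exact hk.symm

/-- Two tensors are equal only if they are related by an arrow of the middle groupoid. -/
lemma exists_of_tens_eq (hS' : S'.IsPrincipal) {x y : Z ⟶ X} {x' y' : Z ⟶ X'}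
    {w : x ≫ S.q = x' ≫ S'.p} {w' : y ≫ S.q = y' ≫ S'.p}
    (h : tens S S' x x' w = tens S S' y y' w') :
    ∃ (k : Z ⟶ H.G₁) (w₁ : y ≫ S.q = k ≫ H.d) (w₂ : k ≫ H.r = x' ≫ S'.p),
      x = S.rmul y k w₁ ∧ S'.smul k x' w₂ = y' := by
  obtain ⟨k, w₁, hk⟩ := hS'.exists_smul_eq y' x' (q_eq_of_tens_eq h).symm
  have w₂ : y ≫ S.q = k ≫ H.d := by rw [w', ← hk, S'.smul_p]
  refine ⟨k, w₂, w₁, ?_, hk⟩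
  -- Here `y ⊗ y' = y ⊗ k x' = y k ⊗ x'`, so both sides have second component `x'`.
  refine tens_left_cancel (w := w) (w' := by simp [w₁]) hS' ?_
  rw [h, rmul_tens _ _ _ _ w₁]
  congr 1
  exact hk.symm

end BilocaleStr

/-! ### The induced bilocale structure and its principality. -/

lemma LeftAction.smul_congr {G : OpenGroupoid.{u}} {X Z : Locale.{u}} {S : LeftAction G X}
    {g g' : Z ⟶ G.G₁} {x x' : Z ⟶ X} {w : g ≫ G.r = x ≫ S.p} {w' : g' ≫ G.r = x' ≫ S.p}
    (hg : g = g') (hx : x = x') : S.smul g x w = S.smul g' x' w' := by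
  subst hg hx
  rfl

lemma RightAction.rmul_congr {H : OpenGroupoid.{u}} {X Z : Locale.{u}} {S : RightAction H X}
    {x x' : Z ⟶ X} {h h' : Z ⟶ H.G₁} {w : x ≫ S.q = h ≫ H.d} {w' : x' ≫ S.q = h' ≫ H.d}
    (hx : x = x') (hh : h = h') : S.rmul x h w = S.rmul x' h' w' := by
  subst hh hx
  rfl

namespace BilocaleStr

variable {G H K : OpenGroupoid.{u}} {X X' Z Z' : Locale.{u}}
  {S : BilocaleStr G H X} {S' : BilocaleStr H K X'}

lemma tens_congr {x y : Z ⟶ X} {x' y' : Z ⟶ X'} {w : x ≫ S.q = x' ≫ S'.p}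
    {w' : y ≫ S.q = y' ≫ S'.p} (h : x = y) (h' : x' = y') :
    tens S S' x x' w = tens S S' y y' w' := by
  subst h h'
  rfl

lemma fst_r_of_snd_eq {b : Z ⟶ pullback G.r (tensorP S S')} {x : Z ⟶ X} {x' : Z ⟶ X'}
    {w : x ≫ S.q = x' ≫ S'.p} (h : b ≫ pullback.snd _ _ = tens S S' x x' w) :
    (b ≫ pullback.fst _ _) ≫ G.r = x ≫ S.p := by
  rw [Category.assoc, pullback.condition, reassoc_of% h, tens_tensorP]

lemma q_eq_of_fst_eq {b : Z ⟶ pullback (tensorQ S S') K.d} {x : Z ⟶ X} {x' : Z ⟶ X'}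
    {w : x ≫ S.q = x' ≫ S'.p} (h : b ≫ pullback.fst _ _ = tens S S' x x' w) :
    x' ≫ S'.q = (b ≫ pullback.snd _ _) ≫ K.d := by
  rw [Category.assoc, ← pullback.condition, reassoc_of% h, tens_tensorQ]

/-- The rule `(g, x ⊗ x') ↦ g x ⊗ x'` makes sense only where the second entry is written as a pure
tensor. That happens locally, and two such expressions differ by an arrow `k` of `H`, for which `g
(y k) ⊗ x' = g y ⊗ k x'`. -/
lemma exists_tensor_act (hS' : S'.IsPrincipal) :
    ∃ act : pullback G.r (tensorP S S') ⟶ tensor S S', ∀ {Z : Locale.{u}}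
      (b : Z ⟶ pullback G.r (tensorP S S')) (x : Z ⟶ X) (x' : Z ⟶ X') (w : x ≫ S.q = x' ≫ S'.p)
      (h : b ≫ pullback.snd _ _ = tens S S' x x' w),
      b ≫ act = tens S S' (S.smul (b ≫ pullback.fst _ _) x (fst_r_of_snd_eq h)) x' (by simp [w]) := by
  refine Exists.imp (fun k hk {Z} b x x' w h => hk b _ ⟨x, x', w, h, rfl⟩) (exists_of_rel (B := pullback G.r (tensorP S S')) (W := tensor S S')
    (fun {Z} b t => ∃ (x : Z ⟶ X) (x' : Z ⟶ X') (w : x ≫ S.q = x' ≫ S'.p)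
      (h : b ≫ pullback.snd _ _ = tens S S' x x' w),
      t = tens S S' (S.smul (b ≫ pullback.fst _ _) x (fst_r_of_snd_eq h)) x' (by simp [w]))
    ?_ ?_ ?_)
  · rintro Z Z' f b _ ⟨x, x', w, h, rfl⟩
    refine ⟨f ≫ x, f ≫ x', by simp [w], by rw [Category.assoc, h, comp_tens], ?_⟩
    rw [comp_tens]
    refine tens_congr ?_ rfl
    rw [LeftAction.comp_smul]
    exact LeftAction.smul_congr (Category.assoc _ _ _).symm rfl
  · rintro Z b _ _ ⟨x, x', w, h, rfl⟩ ⟨y, y', w', h', rfl⟩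
    obtain ⟨k, w₁, w₂, rfl, rfl⟩ := exists_of_tens_eq hS' (h.symm.trans h')
    refine Eq.trans ?_ (rmul_tens (S.smul _ y (fst_r_of_snd_eq h')) k x' (by simp [w₁]) w₂)
    exact tens_congr (smul_rmul _ _ _ _ _).symm rfl
  · obtain ⟨Z, ζ, x, x', w, hζ, h⟩ := exists_tens_eq hS' (pullback.snd G.r (tensorP S S'))
    exact ⟨Z, ζ, _, hζ, x, x', w, h, rfl⟩

lemma exists_tensor_ract (hS' : S'.IsPrincipal) :
    ∃ ract : pullback (tensorQ S S') K.d ⟶ tensor S S', ∀ {Z : Locale.{u}}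
      (b : Z ⟶ pullback (tensorQ S S') K.d) (x : Z ⟶ X) (x' : Z ⟶ X') (w : x ≫ S.q = x' ≫ S'.p)
      (h : b ≫ pullback.fst _ _ = tens S S' x x' w),
      b ≫ ract = tens S S' x (S'.rmul x' (b ≫ pullback.snd _ _) (q_eq_of_fst_eq h))
        (by simp [w]) := by
  refine Exists.imp (fun k hk {Z} b x x' w h => hk b _ ⟨x, x', w, h, rfl⟩) (exists_of_rel (B := pullback (tensorQ S S') K.d) (W := tensor S S')
    (fun {Z} b t => ∃ (x : Z ⟶ X) (x' : Z ⟶ X') (w : x ≫ S.q = x' ≫ S'.p)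
      (h : b ≫ pullback.fst _ _ = tens S S' x x' w),
      t = tens S S' x (S'.rmul x' (b ≫ pullback.snd _ _) (q_eq_of_fst_eq h)) (by simp [w]))
    ?_ ?_ ?_)
  · rintro Z Z' f b _ ⟨x, x', w, h, rfl⟩
    refine ⟨f ≫ x, f ≫ x', by simp [w], by rw [Category.assoc, h, comp_tens], ?_⟩
    rw [comp_tens]
    refine tens_congr rfl ?_
    rw [RightAction.comp_rmul]
    exact RightAction.rmul_congr rfl (Category.assoc _ _ _).symm
  · rintro Z b _ _ ⟨x, x', w, h, rfl⟩ ⟨y, y', w', h', rfl⟩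
    obtain ⟨k, w₁, w₂, rfl, rfl⟩ := exists_of_tens_eq hS' (h.symm.trans h')
    refine Eq.trans (rmul_tens y k (S'.rmul x' _ (q_eq_of_fst_eq h)) w₁ (by simp [w₂])) ?_
    exact tens_congr rfl (smul_rmul _ _ _ _ _).symm
  · obtain ⟨Z, ζ, x, x', w, hζ, h⟩ := exists_tens_eq hS' (pullback.fst (tensorQ S S') K.d)
    exact ⟨Z, ζ, _, hζ, x, x', w, h, rfl⟩

/-- Each axiom is an equation of maps, so it may be checked after composing with a cover `ζ` over
which the element of the tensor product is pure. There `hact_comp` and `hract_comp` reduce it to the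
axioms for `X` and `X'`. -/
lemma exists_isInduced (hS' : S'.IsPrincipal) :
    ∃ T : BilocaleStr G K (tensor S S'), S.IsInduced S' T := by
  obtain ⟨act, hact⟩ := exists_tensor_act (S := S) hS'
  obtain ⟨ract, hract⟩ := exists_tensor_ract (S := S) hS'
  have hact' : ∀ {Z : Locale.{u}} (g : Z ⟶ G.G₁) (t : Z ⟶ tensor S S') (x : Z ⟶ X) (x' : Z ⟶ X')
      (w : x ≫ S.q = x' ≫ S'.p) (h : t = tens S S' x x' w) (w' : g ≫ G.r = t ≫ tensorP S S'),
      pullback.lift g t w' ≫ act =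
        tens S S' (S.smul g x (by rw [w', h, tens_tensorP])) x' (by simp [w]) := by
    intro Z g t x x' w h w'
    rw [hact (pullback.lift g t w') x x' w (by simp [h])]
    exact tens_congr (LeftAction.smul_congr (by simp) rfl) rfl
  have hract' : ∀ {Z : Locale.{u}} (t : Z ⟶ tensor S S') (k : Z ⟶ K.G₁) (x : Z ⟶ X) (x' : Z ⟶ X')
      (w : x ≫ S.q = x' ≫ S'.p) (h : t = tens S S' x x' w) (w' : t ≫ tensorQ S S' = k ≫ K.d),
      pullback.lift t k w' ≫ ract =
        tens S S' x (S'.rmul x' k (by rw [← w', h, tens_tensorQ])) (by simp [w]) := by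
    intro Z t k x x' w h w'
    rw [hract (pullback.lift t k w') x x' w (by simp [h])]
    exact tens_congr rfl (RightAction.rmul_congr rfl (by simp))
  have hact_comp : ∀ {Z Z' : Locale.{u}} (ζ : Z' ⟶ Z) (g : Z ⟶ G.G₁) (t : Z ⟶ tensor S S')
      (x : Z' ⟶ X) (x' : Z' ⟶ X') (w : x ≫ S.q = x' ≫ S'.p) (h : ζ ≫ t = tens S S' x x' w)
      (w' : g ≫ G.r = t ≫ tensorP S S'),
      ζ ≫ pullback.lift g t w' ≫ act = tens S S' (S.smul (ζ ≫ g) x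
        (by rw [Category.assoc, w', reassoc_of% h, tens_tensorP])) x' (by simp [w]) := by
    intro Z Z' ζ g t x x' w h w'
    rw [← hact' (ζ ≫ g) (ζ ≫ t) x x' w h (by simp [w']), ← Category.assoc]
    congr 1
    apply pullback.hom_ext <;> simp
  have hract_comp : ∀ {Z Z' : Locale.{u}} (ζ : Z' ⟶ Z) (t : Z ⟶ tensor S S') (k : Z ⟶ K.G₁)
      (x : Z' ⟶ X) (x' : Z' ⟶ X') (w : x ≫ S.q = x' ≫ S'.p) (h : ζ ≫ t = tens S S' x x' w)
      (w' : t ≫ tensorQ S S' = k ≫ K.d),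
      ζ ≫ pullback.lift t k w' ≫ ract = tens S S' x (S'.rmul x' (ζ ≫ k)
        (by rw [Category.assoc, ← w', reassoc_of% h, tens_tensorQ])) (by simp [w]) := by
    intro Z Z' ζ t k x x' w h w'
    rw [← hract' (ζ ≫ t) (ζ ≫ k) x x' w h (by simp [w']), ← Category.assoc]
    congr 1
    apply pullback.hom_ext <;> simp
  have act_p : act ≫ tensorP S S' = pullback.fst _ _ ≫ G.d := by
    obtain ⟨Z, ζ, x, x', w, hζ, h⟩ := exists_tens_eq hS' (pullback.snd G.r (tensorP S S'))
    have := hζ.epi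
    rw [← cancel_epi ζ, reassoc_of% hact ζ x x' w h]
    simp
  have act_q : act ≫ tensorQ S S' = pullback.snd _ _ ≫ tensorQ S S' := by
    obtain ⟨Z, ζ, x, x', w, hζ, h⟩ := exists_tens_eq hS' (pullback.snd G.r (tensorP S S'))
    have := hζ.epi
    rw [← cancel_epi ζ, reassoc_of% hact ζ x x' w h, reassoc_of% h]
    simp
  have ract_q : ract ≫ tensorQ S S' = pullback.snd _ _ ≫ K.r := by
    obtain ⟨Z, ζ, x, x', w, hζ, h⟩ := exists_tens_eq hS' (pullback.fst (tensorQ S S') K.d)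
    have := hζ.epi
    rw [← cancel_epi ζ, reassoc_of% hract ζ x x' w h]
    simp
  have ract_p : ract ≫ tensorP S S' = pullback.fst _ _ ≫ tensorP S S' := by
    obtain ⟨Z, ζ, x, x', w, hζ, h⟩ := exists_tens_eq hS' (pullback.fst (tensorQ S S') K.d)
    have := hζ.epi
    rw [← cancel_epi ζ, reassoc_of% hract ζ x x' w h, reassoc_of% h]
    simp
  refine ⟨{
    p := tensorP S S'
    act := act
    act_p := act_p
    mul_act := fun {Z} g g' t w₁ w₂ => ?_
    one_act := ?_
    q := tensorQ S S'
    ract := ract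
    ract_q := ract_q
    ract_mul := fun {Z} t k k' w₁ w₂ => ?_
    ract_one := ?_
    act_q := act_q
    ract_p := ract_p
    act_ract := fun {Z} g t k w₁ w₂ => ?_ }, ?_⟩
  · obtain ⟨Z', ζ, x, x', w, hζ, h⟩ := exists_tens_eq hS' t
    have := hζ.epi
    have w₃ : (ζ ≫ g') ≫ G.r = x ≫ S.p := by rw [Category.assoc, w₂, reassoc_of% h, tens_tensorP]
    rw [← cancel_epi ζ]
    refine (hact_comp ζ _ t _ _ w h _).trans (Eq.trans ?_
      (hact_comp ζ g _ _ _ _ (hact_comp ζ g' t _ _ w h _) _).symm)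
    refine tens_congr ?_ rfl
    rw [← LeftAction.mul_smul _ _ _ (by simp [w₁]) w₃]
    exact LeftAction.smul_congr (OpenGroupoid.comp_mul _ _ _ w₁) rfl
  · obtain ⟨Z', ζ, x, x', w, hζ, h⟩ := exists_tens_eq hS' (𝟙 (tensor S S'))
    have := hζ.epi
    rw [← cancel_epi ζ]
    refine (hact_comp ζ _ _ _ _ w h _).trans (Eq.trans ?_ h.symm)
    refine tens_congr ?_ rfl
    rw [Category.comp_id] at h
    refine Eq.trans (LeftAction.smul_congr ?_ rfl) (LeftAction.one_smul x)
    rw [h, ← Category.assoc, tens_tensorP, Category.assoc]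
  · obtain ⟨Z', ζ, x, x', w, hζ, h⟩ := exists_tens_eq hS' t
    have := hζ.epi
    have w₃ : x' ≫ S'.q = (ζ ≫ k) ≫ K.d := by rw [Category.assoc, ← w₁, reassoc_of% h, tens_tensorQ]
    rw [← cancel_epi ζ]
    refine (hract_comp ζ _ k' _ _ _ (hract_comp ζ t k _ _ w h _) _).trans (Eq.trans ?_
      (hract_comp ζ t _ _ _ w h _).symm)
    refine tens_congr rfl ?_
    rw [RightAction.rmul_rmul _ _ _ w₃ (by simp [w₂])]
    exact RightAction.rmul_congr rfl (OpenGroupoid.comp_mul _ _ _ w₂).symm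
  · obtain ⟨Z', ζ, x, x', w, hζ, h⟩ := exists_tens_eq hS' (𝟙 (tensor S S'))
    have := hζ.epi
    rw [← cancel_epi ζ]
    refine (hract_comp ζ _ _ _ _ w h _).trans (Eq.trans ?_ h.symm)
    refine tens_congr rfl ?_
    rw [Category.comp_id] at h
    refine Eq.trans (RightAction.rmul_congr rfl ?_) (RightAction.rmul_one x')
    rw [h, ← Category.assoc, tens_tensorQ, Category.assoc]
  · obtain ⟨Z', ζ, x, x', w, hζ, h⟩ := exists_tens_eq hS' t
    have := hζ.epi
    rw [← cancel_epi ζ]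
    exact (hract_comp ζ _ k _ _ _ (hact_comp ζ g t _ _ w h _) _).trans
      (hact_comp ζ g _ _ _ _ (hract_comp ζ t k _ _ w h _) _).symm
  · exact
      { proj_p := tensorProj_tensorP
        proj_q := tensorProj_tensorQ
        act_proj := fun g x x' w₁ w₂ => hact' g _ x x' w₂ rfl _
        ract_proj := fun x x' k w₁ w₂ => hract' _ k x x' w₁ rfl _ }

namespace IsInduced

variable {T : BilocaleStr G K (tensor S S')} (hT : S.IsInduced S' T)

include hT

lemma tens_p (x : Z ⟶ X) (x' : Z ⟶ X') (w : x ≫ S.q = x' ≫ S'.p) :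
    tens S S' x x' w ≫ T.p = x ≫ S.p := by
  simp [tens, hT.proj_p]

lemma tens_q (x : Z ⟶ X) (x' : Z ⟶ X') (w : x ≫ S.q = x' ≫ S'.p) :
    tens S S' x x' w ≫ T.q = x' ≫ S'.q := by
  simp [tens, hT.proj_q]

lemma smul_tens (g : Z ⟶ G.G₁) (x : Z ⟶ X) (x' : Z ⟶ X') (w₁ : g ≫ G.r = x ≫ S.p)
    (w₂ : x ≫ S.q = x' ≫ S'.p) :
    T.smul g (tens S S' x x' w₂) (by rw [hT.tens_p, w₁]) =
      tens S S' (S.smul g x w₁) x' (by simp [w₂]) :=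
  hT.act_proj g x x' w₁ w₂

lemma tens_rmul (x : Z ⟶ X) (x' : Z ⟶ X') (k : Z ⟶ K.G₁)
    (w₁ : x ≫ S.q = x' ≫ S'.p) (w₂ : x' ≫ S'.q = k ≫ K.d) :
    T.rmul (tens S S' x x' w₁) k (by rw [hT.tens_q, w₂]) =
      tens S S' x (S'.rmul x' k w₂) (by simp [w₁]) :=
  hT.ract_proj x x' k w₁ w₂

lemma unique (hS' : S'.IsPrincipal) {T' : BilocaleStr G K (tensor S S')}
    (hT' : S.IsInduced S' T') : T = T' := by
  have := (tensor_descent (S := S) hS').1.epi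
  have hp : T.p = T'.p := by rw [← cancel_epi (tensorProj S S'), hT.proj_p, hT'.proj_p]
  have hq : T.q = T'.q := by rw [← cancel_epi (tensorProj S S'), hT.proj_q, hT'.proj_q]
  refine ext_elements hp hq (fun g t w => ?_) fun t k w => ?_
  · obtain ⟨Z', ζ, x, x', w', hζ, h⟩ := exists_tens_eq hS' t
    have := hζ.epi
    have w₁ : (ζ ≫ g) ≫ G.r = x ≫ S.p := by rw [Category.assoc, w, reassoc_of% h, hT.tens_p]
    rw [← cancel_epi ζ, LeftAction.comp_smul, LeftAction.comp_smul]
    exact (LeftAction.smul_congr rfl h).trans ((hT.smul_tens _ _ _ w₁ w').trans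
      ((hT'.smul_tens _ _ _ w₁ w').symm.trans (LeftAction.smul_congr rfl h.symm)))
  · obtain ⟨Z', ζ, x, x', w', hζ, h⟩ := exists_tens_eq hS' t
    have := hζ.epi
    have w₁ : x' ≫ S'.q = (ζ ≫ k) ≫ K.d := by rw [Category.assoc, ← w, reassoc_of% h, hT.tens_q]
    rw [← cancel_epi ζ, RightAction.comp_rmul, RightAction.comp_rmul]
    exact (RightAction.rmul_congr h rfl).trans ((hT.tens_rmul _ _ _ w' w₁).trans
      ((hT'.tens_rmul _ _ _ w' w₁).symm.trans (RightAction.rmul_congr h.symm rfl)))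

/-- The tensor product of principal bibundles is principal. -/
theorem isPrincipal (hS : S.IsPrincipal) (hS' : S'.IsPrincipal) : T.IsPrincipal := by
  refine LeftAction.IsPrincipalBundle.of_free_of_local T.act_q ?_ ?_ ?_
  -- Composed with the quotient map, `T.q` becomes `(x, x') ↦ q x'`, a pullback of `S.q` followed by
  -- `S'.q`.
  · refine IsOpenSurj.of_comp (e := tensorProj S S') ?_ (tensor_descent hS').1.isSurjection
    rw [hT.proj_q]
    exact (hS.isOpenSurj.snd _).comp hS'.isOpenSurj
  · intro Z g g' t w w' hg
    obtain ⟨Z', ζ, x, x', w₀, hζ, h⟩ := exists_tens_eq hS' t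
    have := hζ.epi
    have w₁ : (ζ ≫ g) ≫ G.r = x ≫ S.p := by rw [Category.assoc, w, reassoc_of% h, hT.tens_p]
    have w₂ : (ζ ≫ g') ≫ G.r = x ≫ S.p := by rw [Category.assoc, w', reassoc_of% h, hT.tens_p]
    rw [← cancel_epi ζ]
    refine hS.free (w := w₁) (w' := w₂) (tens_left_cancel hS' (x := S.smul _ x w₁)
      (y := S.smul _ x w₂) (x' := x') (w := by rw [smul_q, w₀])
      (w' := by rw [smul_q, w₀]) ?_)
    rw [← hT.smul_tens _ _ _ w₁ w₀, ← hT.smul_tens _ _ _ w₂ w₀]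
    have := ζ ≫= hg
    rw [LeftAction.comp_smul, LeftAction.comp_smul] at this
    refine Eq.trans (LeftAction.smul_congr rfl h.symm)
      (this.trans (LeftAction.smul_congr rfl h))
  · intro Z t s hts
    obtain ⟨Z₁, ζ₁, x, x', w, hζ₁, h₁⟩ := exists_tens_eq hS' t
    obtain ⟨Z₂, ζ₂, y, y', w', hζ₂, h₂⟩ := exists_tens_eq hS' (ζ₁ ≫ s)
    have hq : (ζ₂ ≫ x') ≫ S'.q = y' ≫ S'.q := by
      rw [← hT.tens_q _ _ w', ← h₂]
      simp only [Category.assoc, ← hts, reassoc_of% h₁, hT.tens_q]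
    -- Rewrite `x ⊗ x'` as `z ⊗ y'`. Then `q z = p y' = q y`, so `z = g y` and `g (y ⊗ y') = x ⊗
    -- x'`.
    obtain ⟨z, w'', hz⟩ := exists_tens_eq_right (S := S) hS' (ζ₂ ≫ x) (ζ₂ ≫ x') y' (by simp [w]) hq
    obtain ⟨g, wg, hg⟩ := hS.exists_smul_eq z y (w''.trans w'.symm)
    have hs : (ζ₂ ≫ ζ₁) ≫ s = tens S S' y y' w' := by rw [Category.assoc, h₂]
    refine ⟨Z₂, ζ₂ ≫ ζ₁, g, by rw [hs, wg, hT.tens_p], hζ₂.comp hζ₁, ?_⟩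
    refine (LeftAction.smul_congr rfl hs).trans ((hT.smul_tens g y y' wg w').trans ?_)
    rw [Category.assoc, h₁, comp_tens, hz]
    exact tens_congr hg rfl

end IsInduced

end BilocaleStr

/-! ### Maps of principal bibundles are isomorphisms. -/

namespace Bilocale

variable {G H : OpenGroupoid.{u}} {A B : Bilocale G H} {Z : Locale.{u}}

lemma Hom.smul_f (φ : Hom A B) (g : Z ⟶ G.G₁) (x : Z ⟶ A.X) (w : g ≫ G.r = x ≫ A.str.p) :
    A.str.smul g x w ≫ φ.f = B.str.smul g (x ≫ φ.f) (by rw [Category.assoc, φ.f_p, w]) := by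
  rw [LeftAction.smul, LeftAction.smul, Category.assoc, φ.act_f, ← Category.assoc]
  congr 1
  apply pullback.hom_ext <;> simp

lemma Hom.rmul_f (φ : Hom A B) (x : Z ⟶ A.X) (h : Z ⟶ H.G₁) (w : x ≫ A.str.q = h ≫ H.d) :
    A.str.rmul x h w ≫ φ.f = B.str.rmul (x ≫ φ.f) h (by rw [Category.assoc, φ.f_q, w]) := by
  rw [RightAction.rmul, RightAction.rmul, Category.assoc, φ.ract_f, ← Category.assoc]
  congr 1
  apply pullback.hom_ext <;> simp

/-- A map of bilocales from its compatibility with the actions on generalized elements. -/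
def Hom.ofElements (f : A.X ⟶ B.X) (f_p : f ≫ B.str.p = A.str.p) (f_q : f ≫ B.str.q = A.str.q)
    (smul_f : ∀ {Z : Locale.{u}} (g : Z ⟶ G.G₁) (x : Z ⟶ A.X) (w : g ≫ G.r = x ≫ A.str.p),
      A.str.smul g x w ≫ f = B.str.smul g (x ≫ f) (by rw [Category.assoc, f_p, w]))
    (rmul_f : ∀ {Z : Locale.{u}} (x : Z ⟶ A.X) (h : Z ⟶ H.G₁) (w : x ≫ A.str.q = h ≫ H.d),
      A.str.rmul x h w ≫ f = B.str.rmul (x ≫ f) h (by rw [Category.assoc, f_q, w])) :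
    Hom A B where
  f := f
  f_p := f_p
  f_q := f_q
  act_f := by
    have := smul_f (pullback.fst _ _) (pullback.snd _ _) pullback.condition
    simpa [LeftAction.smul] using this
  ract_f := by
    have := rmul_f (pullback.fst _ _) (pullback.snd _ _) pullback.condition
    simpa [RightAction.rmul] using this

/-- A map of principal bibundles is an isomorphism of locales. -/
lemma Hom.isIso_f (φ : Hom A B) (hA : A.str.IsPrincipal) (hB : B.str.IsPrincipal) :
    IsIso φ.f := by
  refine isIso_of_mono_of_local φ.f (fun {Z} a b h => ?_) ?_
  -- Write `a = g b`. Then `g φ(b) = φ(a) = φ(b)`, so `g` is a unit by freeness of the action on the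
  -- target.
  · have hq : a ≫ A.str.q = b ≫ A.str.q := by rw [← φ.f_q, reassoc_of% h]
    obtain ⟨g, w, hg⟩ := hA.exists_smul_eq a b hq
    have hg' := hg =≫ φ.f
    rw [φ.smul_f, h] at hg'
    have := hB.free (hg'.trans (LeftAction.one_smul (b ≫ φ.f)).symm)
    rw [← hg]
    refine Eq.trans (LeftAction.smul_congr ?_ rfl) (LeftAction.one_smul b)
    rw [this, Category.assoc, reassoc_of% φ.f_p]
  -- Over the cover `A ×_{H₀} B` of `B`, the generic `y` in `B` lies in the fibre of `φ(t)`, so `y =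
  -- g φ(t) = φ(g t)`.
  · let t := pullback.fst A.str.q B.str.q
    obtain ⟨g, w, hg⟩ := hB.exists_smul_eq (pullback.snd A.str.q B.str.q) (t ≫ φ.f)
      (by rw [Category.assoc, φ.f_q, pullback.condition])
    have w' : g ≫ G.r = t ≫ A.str.p := by rw [w, Category.assoc, φ.f_p]
    exact ⟨_, pullback.snd A.str.q B.str.q, A.str.smul g t w', hA.isOpenSurj.snd _,
      (φ.smul_f _ _ _).trans hg⟩

/-- The isomorphism of bilocales given by a map of bilocales that is an isomorphism of locales. -/
noncomputable def Hom.toIso (φ : Hom A B) [IsIso φ.f] : A ≅ B where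
  hom := φ
  inv := Hom.ofElements (inv φ.f) (by rw [IsIso.inv_comp_eq, φ.f_p])
    (by rw [IsIso.inv_comp_eq, φ.f_q])
    (fun g y w => by
      rw [IsIso.comp_inv_eq, φ.smul_f]
      exact LeftAction.smul_congr rfl (by simp))
    (fun y h w => by
      rw [IsIso.comp_inv_eq, φ.rmul_f]
      exact RightAction.rmul_congr (by simp) rfl)
  hom_inv_id := Hom.ext (IsIso.hom_inv_id φ.f)
  inv_hom_id := Hom.ext (IsIso.inv_hom_id φ.f)

end Bilocale

namespace HSMap

variable {G H : OpenGroupoid.{u}}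

/-- All equalities of Hilsum–Skandalis maps below are proved through this: a map in one direction
suffices. -/
lemma mk_eq_of_hom {X Y : Locale.{u}} {S : BilocaleStr G H X} {T : BilocaleStr G H Y}
    (hS : S.IsPrincipal) (hT : T.IsPrincipal) (φ : Bilocale.Hom ⟨X, S⟩ ⟨Y, T⟩) :
    mk S hS = mk T hT :=
  have := φ.isIso_f hS hT
  Quotient.sound ⟨ObjectProperty.isoMk (P := fun A : Bilocale G H => A.str.IsPrincipal)
    (X := ⟨⟨X, S⟩, hS⟩) (Y := ⟨⟨Y, T⟩, hT⟩) φ.toIso⟩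

end HSMap

namespace BilocaleStr

variable {G H K L : OpenGroupoid.{u}} {X X' X'' Y : Locale.{u}}
  {S : BilocaleStr G H X} {S' : BilocaleStr H K X'} {S'' : BilocaleStr K L X''}

/-- A balanced map of bilocales out of `X ×_{H₀} X'` into a principal bibundle identifies the latter
with the tensor product. -/
lemma IsInduced.mk_eq {T : BilocaleStr G K (tensor S S')} (hT : S.IsInduced S' T)
    (hTp : T.IsPrincipal) (hS' : S'.IsPrincipal) {R : BilocaleStr G K Y} (hR : R.IsPrincipal)
    (β : pullback S.q S'.p ⟶ Y) (β_p : β ≫ R.p = pullback.fst _ _ ≫ S.p)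
    (β_q : β ≫ R.q = pullback.snd _ _ ≫ S'.q)
    (balanced : ∀ {Z : Locale.{u}} (x : Z ⟶ X) (h : Z ⟶ H.G₁) (x' : Z ⟶ X')
      (w₁ : x ≫ S.q = h ≫ H.d) (w₂ : h ≫ H.r = x' ≫ S'.p),
      pullback.lift (S.rmul x h w₁) x' (by rw [S.rmul_q, w₂]) ≫ β =
        pullback.lift x (S'.smul h x' w₂) (by rw [S'.smul_p, w₁]) ≫ β)
    (smul_β : ∀ {Z : Locale.{u}} (g : Z ⟶ G.G₁) (x : Z ⟶ X) (x' : Z ⟶ X')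
      (w₁ : g ≫ G.r = x ≫ S.p) (w₂ : x ≫ S.q = x' ≫ S'.p)
      (w₃ : g ≫ G.r = (pullback.lift x x' w₂ ≫ β) ≫ R.p),
      pullback.lift (S.smul g x w₁) x' (by rw [smul_q, w₂]) ≫ β =
        R.smul g (pullback.lift x x' w₂ ≫ β) w₃)
    (rmul_β : ∀ {Z : Locale.{u}} (x : Z ⟶ X) (x' : Z ⟶ X') (k : Z ⟶ K.G₁)
      (w₁ : x ≫ S.q = x' ≫ S'.p) (w₂ : x' ≫ S'.q = k ≫ K.d)
      (w₃ : (pullback.lift x x' w₁ ≫ β) ≫ R.q = k ≫ K.d),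
      pullback.lift x (S'.rmul x' k w₂) (by rw [rmul_p, w₁]) ≫ β =
        R.rmul (pullback.lift x x' w₁ ≫ β) k w₃) :
    HSMap.mk T hTp = HSMap.mk R hR := by
  obtain ⟨f, hf⟩ := exists_tensor_desc β balanced
  have hf' : tensorProj S S' ≫ f = β := by
    have := hf (pullback.fst _ _) (pullback.snd _ _) pullback.condition
    simpa [tens] using this
  have := (tensor_descent (S := S) hS').1.epi
  have f_p : f ≫ R.p = T.p := by
    rw [← cancel_epi (tensorProj S S'), reassoc_of% hf', β_p, hT.proj_p]
  have f_q : f ≫ R.q = T.q := by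
    rw [← cancel_epi (tensorProj S S'), reassoc_of% hf', β_q, hT.proj_q]
  refine HSMap.mk_eq_of_hom hTp hR (Bilocale.Hom.ofElements f f_p f_q (fun g t w => ?_)
    fun t k w => ?_)
  · dsimp only at t w ⊢
    obtain ⟨Z', ζ, x, x', w', hζ, h⟩ := exists_tens_eq hS' t
    have := hζ.epi
    have w₁ : (ζ ≫ g) ≫ G.r = x ≫ S.p := by rw [Category.assoc, w, reassoc_of% h, hT.tens_p]
    rw [← cancel_epi ζ, LeftAction.comp_smul, ← Category.assoc, LeftAction.comp_smul]
    refine ((LeftAction.smul_congr rfl h).trans (hT.smul_tens _ _ _ w₁ w') =≫ f).trans ?_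
    refine ((hf _ _ _).trans (smul_β _ _ _ _ w' ?_)).trans (LeftAction.smul_congr rfl ?_)
    · simp [β_p, ← w₁]
    · rw [← hf, ← h, Category.assoc]
  · dsimp only at t w ⊢
    obtain ⟨Z', ζ, x, x', w', hζ, h⟩ := exists_tens_eq hS' t
    have := hζ.epi
    have w₁ : x' ≫ S'.q = (ζ ≫ k) ≫ K.d := by rw [Category.assoc, ← w, reassoc_of% h, hT.tens_q]
    rw [← cancel_epi ζ, RightAction.comp_rmul, ← Category.assoc, RightAction.comp_rmul]
    refine ((RightAction.rmul_congr h rfl).trans (hT.tens_rmul _ _ _ w' w₁) =≫ f).trans ?_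
    refine ((hf _ _ _).trans (rmul_β _ _ _ w' _ ?_)).trans (RightAction.rmul_congr ?_ rfl)
    · simp [β_q, w₁]
    · rw [← hf, ← h, Category.assoc]

end BilocaleStr

/-! ### The unit bibundle. -/

namespace OpenGroupoid

variable {G : OpenGroupoid.{u}} {Z : Locale.{u}}

lemma mul_congr {g g' h h' : Z ⟶ G.G₁} {w : g ≫ G.r = h ≫ G.d} {w' : g' ≫ G.r = h' ≫ G.d}
    (hg : g = g') (hh : h = h') : G.mul g h w = G.mul g' h' w' := by
  subst hg hh
  rfl

lemma mul_mul_inv (g h : Z ⟶ G.G₁) (w : g ≫ G.r = h ≫ G.d) :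
    G.mul (G.mul g h w) (h ≫ G.i) (by simp [G.i_d]) = g := by
  rw [mul_mul _ _ _ w (by simp [G.i_d])]
  refine (mul_congr rfl ?_).trans (mul_unit g)
  rw [mul_inv_self, reassoc_of% w]

lemma mul_inv_mul (g h : Z ⟶ G.G₁) (w : g ≫ G.r = h ≫ G.r) :
    G.mul (G.mul g (h ≫ G.i) (by simp [G.i_d, w])) h (by simp [G.i_r]) = g := by
  rw [mul_mul _ _ _ (by simp [G.i_d, w]) (by simp [G.i_r])]
  refine (mul_congr rfl ?_).trans (mul_unit g)
  rw [inv_mul_self, reassoc_of% w]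

lemma i_i : G.i ≫ G.i = 𝟙 G.G₁ := by
  have h := mul_mul_inv (𝟙 G.G₁) G.i (by simp [G.i_d])
  rw [← h]
  refine (unit_mul (G.i ≫ G.i)).symm.trans (mul_congr ?_ rfl)
  have := mul_inv_self (𝟙 G.G₁)
  simp only [Category.id_comp] at this
  rw [this, Category.assoc, reassoc_of% G.i_d, reassoc_of% G.i_r]

/-- Openness is assumed for `d` only; it passes to `r = i ≫ d` because inversion is an isomorphism.
The unit map is a section of `d`. -/
lemma isOpenSurj_r (G : OpenGroupoid.{u}) : IsOpenSurj G.r := by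
  have : IsIso G.i := ⟨G.i, i_i, i_i⟩
  rw [← G.i_d]
  exact (IsOpenSurj.of_isIso G.i).comp ⟨G.isOpenMap_d, IsSurjection.of_section G.u_d⟩

end OpenGroupoid

namespace BilocaleStr

/-- The `G`-`G`-bilocale `G₁` is principal. -/
theorem unit_isPrincipal (G : OpenGroupoid.{u}) : (unit G).IsPrincipal := by
  refine LeftAction.IsPrincipalBundle.of_free_of_local (S := (unit G).toLeftAction) G.m_r
    G.isOpenSurj_r ?_ ?_
  · intro Z g g' x w w' h
    rw [← OpenGroupoid.mul_mul_inv g x w, ← OpenGroupoid.mul_mul_inv g' x w']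
    exact OpenGroupoid.mul_congr h rfl
  · intro Z x y (h : x ≫ G.r = y ≫ G.r)
    -- Division is global here: `x = (x y⁻¹) y`, so the trivial cover will do.
    refine ⟨Z, 𝟙 Z, G.mul x (y ≫ G.i) (by simpa [G.i_d] using h), ?_, .of_isIso _, ?_⟩
    · simp [G.i_r, unit]
    · rw [Category.id_comp x]
      exact (OpenGroupoid.mul_congr rfl (Category.id_comp y)).trans
        (OpenGroupoid.mul_inv_mul x y h)

end BilocaleStr

/-! ### Functoriality, unit laws and associativity of the tensor product. -/

namespace BilocaleStr

variable {G H K L : OpenGroupoid.{u}} {X X' X'' Y Y' : Locale.{u}}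
  {S : BilocaleStr G H X} {S' : BilocaleStr H K X'} {S'' : BilocaleStr K L X''}

/-- The bilocale structure on the tensor product with a principal bibundle. -/
noncomputable def tensorStr (S : BilocaleStr G H X) (hS' : S'.IsPrincipal) :
    BilocaleStr G K (tensor S S') :=
  (exists_isInduced hS').choose

lemma isInduced_tensorStr (hS' : S'.IsPrincipal) : S.IsInduced S' (tensorStr S hS') :=
  (exists_isInduced hS').choose_spec

/-- The balanced map is `(x, x') ↦ φ x ⊗ φ' x'`. This makes composition well defined on isomorphism
classes. -/
lemma IsInduced.mk_eq_of_homs {T : BilocaleStr G K (tensor S S')} (hT : S.IsInduced S' T)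
    (hTp : T.IsPrincipal) (hS' : S'.IsPrincipal) {R : BilocaleStr G H Y} {R' : BilocaleStr H K Y'}
    {T' : BilocaleStr G K (tensor R R')} (hT' : R.IsInduced R' T')
    (hTp' : T'.IsPrincipal) (φ : Bilocale.Hom ⟨X, S⟩ ⟨Y, R⟩) (φ' : Bilocale.Hom ⟨X', S'⟩ ⟨Y', R'⟩) :
    HSMap.mk T hTp = HSMap.mk T' hTp' := by
  have w : ∀ {Z : Locale.{u}} (x : Z ⟶ X) (x' : Z ⟶ X') (w : x ≫ S.q = x' ≫ S'.p),
      (x ≫ φ.f) ≫ R.q = (x' ≫ φ'.f) ≫ R'.p := fun x x' w => by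
    rw [Category.assoc, Category.assoc, φ.f_q, φ'.f_p, w]
  have hβ : ∀ {Z : Locale.{u}} (x : Z ⟶ X) (x' : Z ⟶ X') (w' : x ≫ S.q = x' ≫ S'.p),
      pullback.lift x x' w' ≫ tens R R' (pullback.fst _ _ ≫ φ.f) (pullback.snd _ _ ≫ φ'.f)
        (w _ _ pullback.condition) = tens R R' (x ≫ φ.f) (x' ≫ φ'.f) (w _ _ w') := by
    intro Z x x' w'
    rw [comp_tens]
    exact tens_congr (by simp) (by simp)
  refine hT.mk_eq hTp hS' hTp' (tens R R' (pullback.fst _ _ ≫ φ.f) (pullback.snd _ _ ≫ φ'.f)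
    (w _ _ pullback.condition)) ?_ ?_ ?_ ?_ ?_
  · rw [hT'.tens_p, Category.assoc, φ.f_p]
  · rw [hT'.tens_q, Category.assoc, φ'.f_q]
  · intro Z x h x' w₁ w₂
    rw [hβ, hβ]
    refine (tens_congr (φ.rmul_f x h w₁) rfl).trans ((rmul_tens _ _ _ _ ?_).trans
      (tens_congr rfl (φ'.smul_f h x' w₂).symm))
    rw [Category.assoc, φ'.f_p, w₂]
  · intro Z g x x' w₁ w₂ w₃
    rw [hβ]
    have w₄ : g ≫ G.r = (x ≫ φ.f) ≫ R.p := by rw [Category.assoc, φ.f_p, w₁]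
    exact (tens_congr (φ.smul_f g x w₁) rfl).trans ((hT'.smul_tens _ _ _ w₄ (w _ _ w₂)).symm.trans
      (LeftAction.smul_congr rfl (hβ _ _ _).symm))
  · intro Z x x' k w₁ w₂ w₃
    rw [hβ]
    have w₄ : (x' ≫ φ'.f) ≫ R'.q = k ≫ K.d := by rw [Category.assoc, φ'.f_q, w₂]
    exact (tens_congr rfl (φ'.rmul_f x' k w₂)).trans ((hT'.tens_rmul _ _ _ (w _ _ w₁) w₄).symm.trans
      (RightAction.rmul_congr (hβ _ _ _).symm rfl))

/-- The right action `(x, h) ↦ x h` is itself the balanced map; balancedness and right equivariance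
are both its associativity. -/
lemma IsInduced.mk_tensor_unit {T : BilocaleStr G H (tensor S (unit H))}
    (hT : S.IsInduced (unit H) T) (hTp : T.IsPrincipal) (hS : S.IsPrincipal) :
    HSMap.mk T hTp = HSMap.mk S hS :=
  hT.mk_eq hTp (unit_isPrincipal H) hS S.ract S.ract_p S.ract_q
    (fun x h h' w₁ w₂ => RightAction.rmul_rmul (S := S.toRightAction) x h h' w₁ w₂)
    (fun g x h w₁ w₂ _ => smul_rmul (S := S) g x h w₁ w₂)
    (fun x h h' w₁ w₂ _ => (RightAction.rmul_rmul (S := S.toRightAction) x h h' w₁ w₂).symm)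

lemma IsInduced.mk_unit_tensor {T : BilocaleStr G H (tensor (unit G) S)}
    (hT : (unit G).IsInduced S T) (hTp : T.IsPrincipal) (hS : S.IsPrincipal) :
    HSMap.mk T hTp = HSMap.mk S hS :=
  hT.mk_eq hTp hS hS S.act S.act_p S.act_q
    (fun g g' x w₁ w₂ => LeftAction.mul_smul (S := S.toLeftAction) g g' x w₁ w₂)
    (fun g g' x w₁ w₂ _ => LeftAction.mul_smul (S := S.toLeftAction) g g' x w₁ w₂)
    (fun g x h w₁ w₂ _ => (smul_rmul (S := S) g x h w₁ w₂).symm)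

/-- The map `(x ⊗ x', x'') ↦ x ⊗ (x' ⊗ x'')` is built by `exists_of_rel`, since its first argument
is a pure tensor only locally. -/
lemma exists_assoc_map (hS' : S'.IsPrincipal)
    {T₁ : BilocaleStr G K (tensor S S')} (hT₁ : S.IsInduced S' T₁)
    {T₂ : BilocaleStr H L (tensor S' S'')} (hT₂ : S'.IsInduced S'' T₂) :
    ∃ β : pullback T₁.q S''.p ⟶ tensor S T₂, ∀ {Z : Locale.{u}} (b : Z ⟶ pullback T₁.q S''.p)
      (x : Z ⟶ X) (x' : Z ⟶ X') (x'' : Z ⟶ X'') (w₁ : x ≫ S.q = x' ≫ S'.p)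
      (_ : b ≫ pullback.fst _ _ = tens S S' x x' w₁) (_ : b ≫ pullback.snd _ _ = x'')
      (w₂ : x' ≫ S'.q = x'' ≫ S''.p),
      b ≫ β = tens S T₂ x (tens S' S'' x' x'' w₂) (by rw [hT₂.tens_p, w₁]) := by
  refine Exists.imp (fun k hk {Z} b x x' x'' w₁ h h' w₂ => hk b _ ⟨x, x', x'', w₁, h, h', w₂, rfl⟩)
    (exists_of_rel (fun {Z} b t => ∃ (x : Z ⟶ X) (x' : Z ⟶ X') (x'' : Z ⟶ X'')
      (w₁ : x ≫ S.q = x' ≫ S'.p) (_ : b ≫ pullback.fst _ _ = tens S S' x x' w₁)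
      (_ : b ≫ pullback.snd _ _ = x'') (w₂ : x' ≫ S'.q = x'' ≫ S''.p),
      t = tens S T₂ x (tens S' S'' x' x'' w₂) (by rw [hT₂.tens_p, w₁])) ?_ ?_ ?_)
  · rintro Z Z' f b _ ⟨x, x', x'', w₁, h, h', w₂, rfl⟩
    refine ⟨f ≫ x, f ≫ x', f ≫ x'', by simp [w₁], by rw [Category.assoc, h, comp_tens],
      by rw [Category.assoc, h'], by simp [w₂], ?_⟩
    rw [comp_tens]
    exact tens_congr rfl (comp_tens _ _ _ _)
  · rintro Z b _ _ ⟨x, x', x'', w₁, h, h', w₂, rfl⟩ ⟨y, y', y'', w₁', e, e', w₂', rfl⟩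
    obtain rfl := h'.symm.trans e'
    obtain ⟨k, w₃, w₄, rfl, rfl⟩ := exists_of_tens_eq hS' (h.symm.trans e)
    -- Independence of the representative: `y k ⊗ (x' ⊗ x'') = y ⊗ k (x' ⊗ x'') = y ⊗ (k x' ⊗ x'')`.
    refine (rmul_tens (S' := T₂) y k _ w₃ (by rw [w₄, hT₂.tens_p])).trans ?_
    exact tens_congr rfl (hT₂.smul_tens _ _ _ w₄ w₂)
  · obtain ⟨Z, ζ, x, x', w, hζ, h⟩ := exists_tens_eq hS' (pullback.fst T₁.q S''.p)
    refine ⟨Z, ζ, _, hζ, x, x', _, w, h, rfl, ?_, rfl⟩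
    rw [Category.assoc, ← pullback.condition, reassoc_of% h, hT₁.tens_q]

/-- The tensor product of principal bibundles is associative up to isomorphism. -/
theorem IsInduced.mk_assoc (hS' : S'.IsPrincipal) (hS'' : S''.IsPrincipal)
    {T₁ : BilocaleStr G K (tensor S S')} (hT₁ : S.IsInduced S' T₁)
    {T₂ : BilocaleStr H L (tensor S' S'')} (hT₂ : S'.IsInduced S'' T₂)
    {T₃ : BilocaleStr G L (tensor T₁ S'')} (hT₃ : T₁.IsInduced S'' T₃) (hTp₃ : T₃.IsPrincipal)
    {T₄ : BilocaleStr G L (tensor S T₂)} (hT₄ : S.IsInduced T₂ T₄) (hTp₄ : T₄.IsPrincipal) :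
    HSMap.mk T₃ hTp₃ = HSMap.mk T₄ hTp₄ := by
  obtain ⟨β, hβ⟩ := exists_assoc_map hS' hT₁ hT₂
  have hβ' : ∀ {Z Z' : Locale.{u}} (ζ : Z' ⟶ Z) (t : Z ⟶ tensor S S') (z : Z ⟶ X'')
      (w : t ≫ T₁.q = z ≫ S''.p) (x : Z' ⟶ X) (x' : Z' ⟶ X') (w₁ : x ≫ S.q = x' ≫ S'.p)
      (h : ζ ≫ t = tens S S' x x' w₁), ζ ≫ pullback.lift t z w ≫ β =
        tens S T₂ x (tens S' S'' x' (ζ ≫ z) (by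
          rw [Category.assoc, ← w, reassoc_of% h, hT₁.tens_q])) (by rw [hT₂.tens_p, w₁]) := by
    intro Z Z' ζ t z w x x' w₁ h
    rw [← Category.assoc]
    exact hβ (ζ ≫ pullback.lift t z w) x x' _ w₁ (by simp [h]) (by simp) _
  refine hT₃.mk_eq hTp₃ hS'' hTp₄ β ?_ ?_ ?_ ?_ ?_
  · obtain ⟨Z, ζ, x, x', w, hζ, h⟩ := exists_tens_eq hS' (pullback.fst T₁.q S''.p)
    have := hζ.epi
    have w₂ : x' ≫ S'.q = (ζ ≫ pullback.snd T₁.q S''.p) ≫ S''.p := by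
      rw [Category.assoc, ← pullback.condition, reassoc_of% h, hT₁.tens_q]
    rw [← cancel_epi ζ, reassoc_of% hβ ζ x x' _ w h rfl w₂, reassoc_of% h, hT₄.tens_p, hT₁.tens_p]
  · obtain ⟨Z, ζ, x, x', w, hζ, h⟩ := exists_tens_eq hS' (pullback.fst T₁.q S''.p)
    have := hζ.epi
    have w₂ : x' ≫ S'.q = (ζ ≫ pullback.snd T₁.q S''.p) ≫ S''.p := by
      rw [Category.assoc, ← pullback.condition, reassoc_of% h, hT₁.tens_q]
    rw [← cancel_epi ζ, reassoc_of% hβ ζ x x' _ w h rfl w₂, hT₄.tens_q, hT₂.tens_q, Category.assoc]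
  · intro Z t k z w₁ w₂
    obtain ⟨Z', ζ, x, x', w, hζ, h⟩ := exists_tens_eq hS' t
    have := hζ.epi
    have w₃ : x' ≫ S'.q = (ζ ≫ k) ≫ K.d := by
      rw [Category.assoc, ← w₁, reassoc_of% h, hT₁.tens_q]
    have h' : ζ ≫ T₁.rmul t k w₁ = tens S S' x (S'.rmul x' (ζ ≫ k) w₃) (by rw [rmul_p, w]) := by
      rw [RightAction.comp_rmul]
      exact (RightAction.rmul_congr h rfl).trans (hT₁.tens_rmul _ _ _ _ _)
    rw [← cancel_epi ζ, hβ' ζ _ _ _ _ _ _ h', hβ' ζ _ _ _ _ _ _ h]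
    refine tens_congr rfl ((rmul_tens _ _ _ _ (by simp [w₂])).trans (tens_congr rfl ?_))
    exact (LeftAction.comp_smul _ _ _ _).symm
  · intro Z g t z w₁ w₂ w₃
    obtain ⟨Z', ζ, x, x', w, hζ, h⟩ := exists_tens_eq hS' t
    have := hζ.epi
    have w₄ : (ζ ≫ g) ≫ G.r = x ≫ S.p := by
      rw [Category.assoc, w₁, reassoc_of% h, hT₁.tens_p]
    have h' : ζ ≫ T₁.smul g t w₁ = tens S S' (S.smul (ζ ≫ g) x w₄) x' (by rw [smul_q, w]) := by
      rw [LeftAction.comp_smul]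
      exact (LeftAction.smul_congr rfl h).trans (hT₁.smul_tens _ _ _ _ _)
    rw [← cancel_epi ζ, hβ' ζ _ _ _ _ _ _ h']
    refine Eq.trans ?_ (LeftAction.comp_smul _ _ _ _).symm
    exact (hT₄.smul_tens _ _ _ _ _).symm.trans
      (LeftAction.smul_congr rfl (hβ' ζ _ _ w₂ _ _ _ h).symm)
  · intro Z t z k w₁ w₂ w₃
    obtain ⟨Z', ζ, x, x', w, hζ, h⟩ := exists_tens_eq hS' t
    have := hζ.epi
    rw [← cancel_epi ζ, hβ' ζ _ _ _ _ _ _ h]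
    refine Eq.trans ?_ (RightAction.comp_rmul _ _ _ _).symm
    have w₄ : x' ≫ S'.q = (ζ ≫ z) ≫ S''.p := by
      rw [Category.assoc, ← w₁, reassoc_of% h, hT₁.tens_q]
    have w₅ : (ζ ≫ z) ≫ S''.q = (ζ ≫ k) ≫ L.d := by rw [Category.assoc, w₂, Category.assoc]
    have w₆ : tens S' S'' x' (ζ ≫ z) w₄ ≫ T₂.q = (ζ ≫ k) ≫ L.d := by rw [hT₂.tens_q, w₅]
    have w₇ : x ≫ S.q = tens S' S'' x' (ζ ≫ z) w₄ ≫ T₂.p := by rw [hT₂.tens_p, w]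
    refine (tens_congr rfl ?_).trans ((hT₄.tens_rmul x _ (ζ ≫ k) w₇ w₆).symm.trans
      (RightAction.rmul_congr (hβ' ζ _ _ w₁ _ _ _ h).symm rfl))
    exact (tens_congr rfl (RightAction.comp_rmul _ _ _ _)).trans
      (hT₂.tens_rmul x' (ζ ≫ z) (ζ ≫ k) w₄ w₅).symm

end BilocaleStr

/-! ### The category of Hilsum–Skandalis maps. -/

namespace HSMap

open BilocaleStr

/-- The composite of Hilsum-Skandalis maps. -/
noncomputable def comp {K H G : OpenGroupoid.{u}} (a : HSMap K H) (b : HSMap H G) : HSMap K G :=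
  Quotient.liftOn₂ a b
    (fun A' A => mk (tensorStr A.obj.str A'.property)
      ((isInduced_tensorStr A'.property).isPrincipal A.property A'.property))
    (by
      rintro A' A B' B ⟨e'⟩ ⟨e⟩
      exact (isInduced_tensorStr A'.property).mk_eq_of_homs _ A'.property
        (isInduced_tensorStr B'.property) _ e.hom.hom e'.hom.hom)

/-- Uniqueness of the induced structure removes the choice made in `tensorStr`. -/
lemma comp_mk_mk {G H K : OpenGroupoid.{u}} {X X' : Locale.{u}} {S : BilocaleStr G H X}
    {S' : BilocaleStr H K X'} (hS : S.IsPrincipal) (hS' : S'.IsPrincipal)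
    {T : BilocaleStr G K (S.tensor S')} (hT : T.IsPrincipal) (h : S.IsInduced S' T) :
    comp (mk S' hS') (mk S hS) = mk T hT := by
  obtain rfl := (isInduced_tensorStr hS').unique hS' h
  rfl

lemma exists_eq_mk {G H : OpenGroupoid.{u}} (a : HSMap H G) :
    ∃ (X : Locale.{u}) (S : BilocaleStr G H X) (hS : S.IsPrincipal), a = mk S hS := by
  obtain ⟨⟨⟨X, S⟩, hS⟩, rfl⟩ := Quotient.exists_rep a
  exact ⟨X, S, hS, rfl⟩

/-- The category of open groupoids and Hilsum-Skandalis maps. -/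
@[reducible]
noncomputable def category : Category.{u + 1} OpenGroupoid.{u} where
  Hom := HSMap
  id G := mk (unit G) (unit_isPrincipal G)
  comp := comp
  -- Composition is in diagrammatic order, opposite to the order of tensor factors: precomposing
  -- with the identity means tensoring with the unit bibundle on the right.
  id_comp a := by
    obtain ⟨X, S, hS, rfl⟩ := exists_eq_mk a
    have h := isInduced_tensorStr (S := S) (unit_isPrincipal _)
    have hp := h.isPrincipal hS (unit_isPrincipal _)
    exact (comp_mk_mk hS (unit_isPrincipal _) hp h).trans (h.mk_tensor_unit hp hS)
  comp_id a := by
    obtain ⟨X, S, hS, rfl⟩ := exists_eq_mk a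
    have h := isInduced_tensorStr (S := unit _) hS
    have hp := h.isPrincipal (unit_isPrincipal _) hS
    exact (comp_mk_mk (unit_isPrincipal _) hS hp h).trans (h.mk_unit_tensor hp hS)
  assoc a b c := by
    obtain ⟨X'', S'', hS'', rfl⟩ := exists_eq_mk a
    obtain ⟨X', S', hS', rfl⟩ := exists_eq_mk b
    obtain ⟨X, S, hS, rfl⟩ := exists_eq_mk c
    have h₁ := isInduced_tensorStr (S := S) hS'
    have h₂ := isInduced_tensorStr (S := S') hS''
    have p₁ := h₁.isPrincipal hS hS'
    have p₂ := h₂.isPrincipal hS' hS''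
    have h₃ := isInduced_tensorStr (S := tensorStr S hS') hS''
    have h₄ := isInduced_tensorStr (S := S) p₂
    have p₃ := h₃.isPrincipal p₁ hS''
    have p₄ := h₄.isPrincipal hS p₂
    change comp (comp _ _) _ = comp _ (comp _ _)
    rw [comp_mk_mk hS' hS'' p₂ h₂, comp_mk_mk hS hS' p₁ h₁, comp_mk_mk hS p₂ p₄ h₄,
      comp_mk_mk p₁ hS'' p₃ h₃]
    exact (h₁.mk_assoc hS' hS'' h₂ h₃ p₃ h₄ p₄).symm

end HSMap

theorem mainTheorem5 :
    (∀ (G H K : OpenGroupoid.{u}) (X X' : Locale.{u})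
      (S : BilocaleStr G H X) (S' : BilocaleStr H K X'), S.IsPrincipal → S'.IsPrincipal →
        (∃! T : BilocaleStr G K (S.tensor S'), S.IsInduced S' T) ∧
        ∀ T : BilocaleStr G K (S.tensor S'), S.IsInduced S' T → T.IsPrincipal) ∧
    ∃ (unit_principal : ∀ G : OpenGroupoid.{u}, (BilocaleStr.unit G).IsPrincipal)
      (comp : ∀ {K H G : OpenGroupoid.{u}}, HSMap K H → HSMap H G → HSMap K G),
      (∀ (G H K : OpenGroupoid.{u}) (X X' : Locale.{u})
        (S : BilocaleStr G H X) (S' : BilocaleStr H K X') (hS : S.IsPrincipal)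
        (hS' : S'.IsPrincipal) (T : BilocaleStr G K (S.tensor S')) (hT : T.IsPrincipal),
        S.IsInduced S' T → comp (HSMap.mk S' hS') (HSMap.mk S hS) = HSMap.mk T hT) ∧
      ∃ C : CategoryTheory.Category.{u + 1} OpenGroupoid.{u},
        C.toCategoryStruct =
          { Hom := HSMap
            id := fun G => HSMap.mk (BilocaleStr.unit G) (unit_principal G)
            comp := comp } := by
  refine ⟨fun G H K X X' S S' hS hS' => ⟨?_, fun T hT => hT.isPrincipal hS hS'⟩,
    BilocaleStr.unit_isPrincipal, HSMap.comp,
    fun G H K X X' S S' hS hS' T hT h => HSMap.comp_mk_mk hS hS' hT h, HSMap.category, rfl⟩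
  obtain ⟨T, hT⟩ := BilocaleStr.exists_isInduced (S := S) hS'
  exact ⟨T, hT, fun T' hT' => hT'.unique hS' hT⟩
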